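/- Let $k\ge 2$ and let $a=(a(n))_{n\ge 0}$ be a synchronizing $k$-automatic sequence with values in an alphabet $\mathcal A$; that is, there is a finite deterministic automaton with output, in which every state has exactly one outgoing edge labelled $d$ for each digit $d\in\{0,1,\dots,k-1\}$, such that $a(n)$ is the output of the state reached from the initial state by reading the base-$k$ expansion of $n$, most significant digit first, and such that some word $w\in\{0,1,\dots,k-1\}^*$ leads from every state of the automaton to one and the same state. Let $(p_n)_{n\ge 0}$ be the increasing sequence of all prime numbers, and let $c>1$ be a real number that is not an integer. Then for every letter $\alpha\in\mathcal A$ the limits $$\lim_{N\to\infty}\frac1N\,\#\{0\le n<N : a(n)=\alpha\}\qquad\text{and}\qquad \lim_{N\to\infty}\frac1N\,\#\{0\le n<N : a(\lfloor p_n^c\rfloor)=\alpha\}$$ exist and are equal. -/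

import Mathlib

open Filter Topology

/-- A deterministic automaton with output: every state has `k` outgoing edges, labelled by the
digits `0, …, k-1`; there is an initial state and every state carries an output letter. -/
structure OutputAutomaton (k : ℕ) (σ : Type) (A : Type*) where
  step : σ → Fin k → σ
  start : σ
  output : σ → A

namespace OutputAutomaton

variable {k : ℕ} {σ : Type} {A : Type*}

/-- The state reached from `s` after reading the word `w` from left to right. -/
def run (M : OutputAutomaton k σ A) (s : σ) (w : List (Fin k)) : σ :=
  w.foldl M.step s

/-- `w` is a synchronizing (reset) word: it leads to one state from every starting state. -/
def IsSynchronizingWord (M : OutputAutomaton k σ A) (w : List (Fin k)) : Prop :=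
  ∃ s : σ, ∀ t : σ, M.run t w = s

end OutputAutomaton

/-- The base-`k` expansion of `n`, most significant digit first, without leading zeros
(so that the expansion of `0` is the empty word). -/
def baseExpansion (k : ℕ) (hk : 2 ≤ k) (n : ℕ) : List (Fin k) :=
  (Nat.digits k n).reverse.pmap Fin.mk
    (fun _ hd => Nat.digits_lt_base hk (List.mem_reverse.mp hd))

/-- The automaton `M` generates the sequence `a`. -/
def OutputAutomaton.Generates {k : ℕ} {σ : Type} {A : Type*} (M : OutputAutomaton k σ A)
    (hk : 2 ≤ k) (a : ℕ → A) : Prop :=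
  ∀ n : ℕ, a n = M.output (M.run M.start (baseExpansion k hk n))

/-- `a` is a synchronizing `k`-automatic sequence: it is generated by a finite automaton that has a
synchronizing word. (Restricting a synchronizing automaton to its reachable states and merging
equivalent states keeps it synchronizing, so asking this of the minimal automaton is the same.) -/
def IsSynchronizingAutomatic {A : Type*} (k : ℕ) (hk : 2 ≤ k) (a : ℕ → A) : Prop :=
  ∃ (σ : Type) (_ : Finite σ) (M : OutputAutomaton k σ A),
    M.Generates hk a ∧ ∃ w : List (Fin k), M.IsSynchronizingWord w

/-- The letter `α` has asymptotic frequency `ϑ` in the sequence `b`: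
`#{n < N : b n = α} / N → ϑ` as `N → ∞`. -/
def HasFrequency {A : Type*} (b : ℕ → A) (α : A) (ϑ : ℝ) : Prop :=
  Tendsto (fun N : ℕ => (Set.ncard {n : ℕ | n < N ∧ b n = α} : ℝ) / (N : ℝ)) atTop (𝓝 ϑ)

/-! Once a synchronizing word `w` has been read, the state no longer depends on the past. If the
last `L` base-`k` digits of `n` contain `w`, the state reached by `n` is therefore determined by `n`
modulo `k ^ L`. Cutting these digits into blocks of length `|w|` shows that the proportion of
residues avoiding `w` decays exponentially in the number of blocks. Up to any prescribed error, `a`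
is thus a function of the residue, and it has one and the same frequency of `α` along all sequences
that tend to infinity and are equidistributed modulo every `q`. The identity is such a sequence, so
what remains is the equidistribution of `⌊p ^ c⌋` modulo `q` (`exists_frequency_approx`,
`equidistributedMod_floor_prime_rpow`).

The residue of `⌊y⌋` modulo `q` is read off from `y / q` modulo 1, so Weyl's criterion reduces the
claim to cancellation in `∑ e (α p ^ c)` over primes for fixed `α ≠ 0`. Vaughan's identity splits
the sum weighted by the von Mangoldt function into sums with one smooth variable and bilinear sums
with both variables large. By Cauchy–Schwarz and `(d m) ^ c = d ^ c m ^ c`, both kinds lead to sums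
of `e (β n ^ c)` over integers of an interval, with `|β|` bounded below and at most a power of the
length (`norm_sum_Ico_e_le`).

Those sums are treated by van der Corput's method: enough differencing steps bring the second
differences of the phase into a range where the second difference test saves a power.
Non-integrality of `c` enters here: no derivative of `x ^ c` vanishes identically, however many
differencing steps the size of `β` requires. -/

namespace PrimePowerSums

/-! ### The additive character and the second difference test -/

/-- The additive character `x ↦ exp (2πix)` of the real line. -/
noncomputable def e (x : ℝ) : ℂ := Complex.exp (Complex.I * ((2 * Real.pi * x : ℝ) : ℂ))

lemma norm_e (x : ℝ) : ‖e x‖ = 1 := by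
  rw [e, mul_comm, Complex.norm_exp_ofReal_mul_I]

lemma e_add (x y : ℝ) : e (x + y) = e x * e y := by
  simp only [e, ← Complex.exp_add]
  congr 1
  push_cast
  ring

lemma e_neg (x : ℝ) : e (-x) = starRingEnd ℂ (e x) := by
  simp only [e, ← Complex.exp_conj]
  congr 1
  rw [map_mul, Complex.conj_I, Complex.conj_ofReal]
  push_cast
  ring

lemma e_int (n : ℤ) : e n = 1 := by
  rw [e, Complex.exp_eq_one_iff]
  exact ⟨n, by push_cast; ring⟩

lemma e_sub (x y : ℝ) : e (x - y) = e x * starRingEnd ℂ (e y) := by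
  rw [sub_eq_add_neg, e_add, e_neg]

lemma norm_e_sub_e_le (x y : ℝ) : ‖e x - e y‖ ≤ 2 * Real.pi * |x - y| := by
  have h : e x - e y = e y * (e (x - y) - 1) := by
    rw [mul_sub, ← e_add]; simp
  rw [h, norm_mul, norm_e, one_mul]
  refine (Real.norm_exp_I_mul_ofReal_sub_one_le).trans ?_
  rw [Real.norm_eq_abs, abs_mul, abs_of_pos (by positivity : 0 < 2 * Real.pi)]

/-- Since `|e x - 1| = 2 |sin (π x)|`, Jordan's inequality bounds the chord below by four times the
distance to the nearest integer. -/
lemma four_mul_le_norm_e_sub_one {x δ : ℝ} (v : ℤ) (hδ : 0 ≤ δ) (h1 : v + δ ≤ x)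
    (h2 : x ≤ v + 1 - δ) : 4 * δ ≤ ‖e x - 1‖ := by
  have hx : e x = e (x - v) := by
    rw [e_sub, e_int]; simp
  have key : 2 * δ ≤ Real.sin (Real.pi * (x - v)) := by
    have hpi := Real.pi_pos
    rcases le_total (x - v) (1 / 2) with h | h
    · have := Real.mul_le_sin (x := Real.pi * (x - v)) (by
        apply mul_nonneg hpi.le; linarith) (by nlinarith)
      have h3 : 2 / Real.pi * (Real.pi * (x - v)) = 2 * (x - v) := by field_simp
      linarith
    · have := Real.mul_le_sin (x := Real.pi * (1 - (x - v))) (by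
        apply mul_nonneg hpi.le; linarith) (by nlinarith)
      have h3 : 2 / Real.pi * (Real.pi * (1 - (x - v))) = 2 * (1 - (x - v)) := by field_simp
      have h4 : Real.sin (Real.pi * (1 - (x - v))) = Real.sin (Real.pi * (x - v)) := by
        rw [← Real.sin_pi_sub]; congr 1; ring
      linarith
  rw [hx, e, Complex.norm_exp_I_mul_ofReal_sub_one, Real.norm_eq_abs]
  have h5 : 2 * Real.pi * (x - v) / 2 = Real.pi * (x - v) := by ring
  rw [h5]
  refine le_trans ?_ (le_abs_self _)
  linarith

/-- A weak form of the Kusmin–Landau inequality. -/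
lemma norm_sum_e_le_of_diff_mem (g : ℕ → ℝ) (a b : ℕ) {δ : ℝ} (hδ : 0 < δ) (hδ' : δ ≤ 1 / 2)
    (v : ℤ) (h1 : ∀ n ∈ Finset.Ico a b, v + δ ≤ g (n + 1) - g n ∧ g (n + 1) - g n ≤ v + 1 - δ)
    (h2 : ∀ n ∈ Finset.Ico a b, g (n + 1) - g n ≤ g (n + 2) - g (n + 1)) :
    ‖∑ n ∈ Finset.Ico a b, e (g n)‖ ≤ 1 / δ ^ 2 := by
  rcases le_or_gt b a with hab | hab
  · rw [Finset.Ico_eq_empty_of_le hab]; simp; positivity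
  -- Each term is `C n` times a difference of consecutive terms, so summation by parts leaves two
  -- boundary terms and the total variation of `C`. Monotonicity of the phase differences makes the
  -- bound for this variation telescope. Bounding both factors `C n` and `C (n + 1)` by `1 / (4 δ)`
  -- costs a power of `δ` against the sharp inequality, which is harmless here.
  set C : ℕ → ℂ := fun n => (e (g (n + 1) - g n) - 1)⁻¹ with hC
  have hlow : ∀ n ∈ Finset.Ico a b, 4 * δ ≤ ‖e (g (n + 1) - g n) - 1‖ := fun n hn =>
    four_mul_le_norm_e_sub_one v hδ.le (h1 n hn).1 (h1 n hn).2
  have hne : ∀ n ∈ Finset.Ico a b, e (g (n + 1) - g n) - 1 ≠ 0 := fun n hn h0 => by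
    have := hlow n hn
    rw [h0, norm_zero] at this
    linarith
  have hCb : ∀ n ∈ Finset.Ico a b, ‖C n‖ ≤ 1 / (4 * δ) := fun n hn => by
    simp only [hC]
    rw [norm_inv, ← one_div]
    exact one_div_le_one_div_of_le (by positivity) (hlow n hn)
  have hstep : ∀ n ∈ Finset.Ico a b, e (g n) = C n * (e (g (n + 1)) - e (g n)) := fun n hn => by
    have : e (g (n + 1)) = e (g n) * e (g (n + 1) - g n) := by rw [← e_add]; simp
    rw [this, hC, ← mul_sub_one]
    field_simp [hne n hn]
  have hdiff : ∀ n, a ≤ n → n + 1 < b → ‖C n - C (n + 1)‖ ≤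
      2 * Real.pi / (16 * δ ^ 2) * ((g (n + 2) - g (n + 1)) - (g (n + 1) - g n)) := by
    intro n hn hnb
    have m1 : n ∈ Finset.Ico a b := Finset.mem_Ico.2 ⟨hn, by omega⟩
    have m2 : n + 1 ∈ Finset.Ico a b := Finset.mem_Ico.2 ⟨by omega, hnb⟩
    have : C n - C (n + 1) = (e (g (n + 2) - g (n + 1)) - e (g (n + 1) - g n)) * (C n * C (n + 1)) := by
      have := hne n m1
      have := hne (n + 1) m2
      simp only [hC]
      field_simp
      ring
    rw [this, norm_mul, norm_mul]
    calc _ ≤ (2 * Real.pi * |(g (n + 2) - g (n + 1)) - (g (n + 1) - g n)|) *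
          (1 / (4 * δ) * (1 / (4 * δ))) := by
          gcongr
          · exact norm_e_sub_e_le _ _
          · exact hCb n m1
          · exact hCb _ m2
      _ = _ := by
          rw [abs_of_nonneg (by linarith [h2 n m1])]
          field_simp
          norm_num
  have main : ∀ m, a + m < b → ‖∑ n ∈ Finset.Ico a (a + m + 1), e (g n) -
      (C (a + m) * e (g (a + m + 1)) - C a * e (g a))‖ ≤
      2 * Real.pi / (16 * δ ^ 2) * ((g (a + m + 1) - g (a + m)) - (g (a + 1) - g a)) := by
    intro m
    induction m with
    | zero =>
      intro hm
      have := hstep a (Finset.mem_Ico.2 ⟨le_rfl, hm⟩)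
      simp only [add_zero, Nat.Ico_succ_singleton, Finset.sum_singleton]
      have h0 : e (g a) - (C a * e (g (a + 1)) - C a * e (g a)) = 0 := by
        rw [← mul_sub, ← this, sub_self]
      rw [h0]; simp
    | succ m ih =>
      intro hm
      have ih := ih (by omega)
      have hs := hstep (a + m + 1) (Finset.mem_Ico.2 ⟨by omega, by omega⟩)
      have hd := hdiff (a + m) (by omega) (by omega)
      rw [← add_assoc, Finset.sum_Ico_succ_top (by omega)]
      set X := ∑ n ∈ Finset.Ico a (a + m + 1), e (g n)
      have : X + e (g (a + m + 1)) - (C (a + m + 1) * e (g (a + m + 1 + 1)) - C a * e (g a)) =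
        (X - (C (a + m) * e (g (a + m + 1)) - C a * e (g a))) +
          (C (a + m) - C (a + m + 1)) * e (g (a + m + 1)) := by
        linear_combination hs
      rw [this]
      refine (norm_add_le _ _).trans ?_
      rw [norm_mul, norm_e, mul_one]
      refine (add_le_add ih hd).trans (le_of_eq ?_)
      ring
  obtain ⟨m, rfl⟩ : ∃ m, b = a + m + 1 := ⟨b - a - 1, by omega⟩
  have hm := main m (by omega)
  have mA : a ∈ Finset.Ico a (a + m + 1) := Finset.mem_Ico.2 ⟨by omega, by omega⟩
  have mB : a + m ∈ Finset.Ico a (a + m + 1) := Finset.mem_Ico.2 ⟨by omega, by omega⟩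
  have t1 : ‖C (a + m) * e (g (a + m + 1)) - C a * e (g a)‖ ≤ 1 / (4 * δ) + 1 / (4 * δ) := by
    refine (norm_sub_le _ _).trans ?_
    rw [norm_mul, norm_mul, norm_e, norm_e, mul_one, mul_one]
    exact add_le_add (hCb _ mB) (hCb _ mA)
  have t2 : (g (a + m + 1) - g (a + m)) - (g (a + 1) - g a) ≤ 1 := by
    linarith [(h1 _ mA).1, (h1 _ mB).2]
  have t3 : 2 * Real.pi / (16 * δ ^ 2) * ((g (a + m + 1) - g (a + m)) - (g (a + 1) - g a)) ≤
      (1 / 2) / δ ^ 2 := by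
    calc _ ≤ 2 * Real.pi / (16 * δ ^ 2) * 1 := by gcongr
      _ = (2 * Real.pi / 16) / δ ^ 2 := by field_simp
      _ ≤ _ := by
        exact div_le_div_of_nonneg_right (by linarith [Real.pi_le_four]) (by positivity)
  have t4 : 1 / (4 * δ) + 1 / (4 * δ) ≤ (1 / 2) / δ ^ 2 := by
    rw [← add_div, div_le_div_iff₀ (by positivity) (by positivity)]
    nlinarith
  have t5 := norm_sub_norm_le (∑ n ∈ Finset.Ico a (a + m + 1), e (g n))
    (C (a + m) * e (g (a + m + 1)) - C a * e (g a))
  have t6 : 1 / δ ^ 2 = (1 / 2) / δ ^ 2 + (1 / 2) / δ ^ 2 := by ring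
  linarith

/-- A sequence whose steps are at least `l` visits an interval of length `L` at most `L / l + 1`
times. -/
lemma card_le_of_forall_mem_Icc {d : ℕ → ℝ} {N : ℕ} {l x L : ℝ} (hl : 0 < l)
    (hd : ∀ n < N, l ≤ d (n + 1) - d n) (hL : 0 ≤ L) (s : Finset ℕ) (hs : ∀ n ∈ s, n < N)
    (hx : ∀ n ∈ s, x ≤ d n ∧ d n ≤ x + L) : (s.card : ℝ) ≤ L / l + 1 := by
  rcases s.eq_empty_or_nonempty with rfl | hne
  · simp; positivity
  have hgrow : ∀ m n, n + m ≤ N → m * l ≤ d (n + m) - d n := by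
    intro m
    induction m with
    | zero => intro n _; simp
    | succ m ih =>
      intro n hn
      have h1 := ih n (by omega)
      have h2 := hd (n + m) (by omega)
      push_cast
      rw [← add_assoc]
      linarith
  set p := s.min' hne
  set q := s.max' hne
  have hp := s.min'_mem hne
  have hq := s.max'_mem hne
  have hpq : p ≤ q := s.min'_le_max' hne
  have hsub : s ⊆ Finset.Icc p q := fun n hn =>
    Finset.mem_Icc.2 ⟨s.min'_le n hn, s.le_max' n hn⟩
  have hc := Finset.card_le_card hsub
  rw [Nat.card_Icc] at hc
  have h1 := hgrow (q - p) p (by have := hs q hq; omega)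
  rw [Nat.add_sub_cancel' hpq] at h1
  have h2 : ((q - p : ℕ) : ℝ) ≤ L / l := by
    rw [le_div_iff₀ hl]
    linarith [(hx p hp).1, (hx q hq).2]
  have h3 : (s.card : ℝ) ≤ ((q - p : ℕ) : ℝ) + 1 := by
    exact_mod_cast (by omega : s.card ≤ (q - p) + 1)
  linarith

lemma exists_eq_Ico_of_ordConnected (s : Finset ℕ)
    (h : ∀ x ∈ s, ∀ y ∈ s, ∀ z, x ≤ z → z ≤ y → z ∈ s) : ∃ a b, s = Finset.Ico a b := by
  rcases s.eq_empty_or_nonempty with rfl | hne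
  · exact ⟨0, 0, by simp⟩
  refine ⟨s.min' hne, s.max' hne + 1, ?_⟩
  ext n
  rw [Finset.mem_Ico]
  refine ⟨fun hn => ⟨s.min'_le n hn, Nat.lt_succ_of_le (s.le_max' n hn)⟩, fun hn => ?_⟩
  exact h _ (s.min'_mem hne) _ (s.max'_mem hne) n hn.1 (by omega)

lemma norm_sum_e_le_card (s : Finset ℕ) (g : ℕ → ℝ) : ‖∑ n ∈ s, e (g n)‖ ≤ s.card := by
  refine (norm_sum_le _ _).trans ?_
  simp [norm_e]

/-- The second difference test, with a parameter `δ` to be optimised. -/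
lemma norm_sum_e_le_of_second_diff_aux (g : ℕ → ℝ) (N : ℕ) {l K δ : ℝ} (hl : 0 < l)
    (hδ : 0 < δ) (hδ' : δ ≤ 1 / 2) (_hK : 0 ≤ K)
    (h : ∀ n < N, l ≤ (g (n + 2) - g (n + 1)) - (g (n + 1) - g n) ∧
      (g (n + 2) - g (n + 1)) - (g (n + 1) - g n) ≤ K * l) :
    ‖∑ n ∈ Finset.range N, e (g n)‖ ≤ (N * (K * l) + 2) * (2 * (δ / l + 1) + 1 / δ ^ 2) := by
  set d : ℕ → ℝ := fun n => g (n + 1) - g n with hd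
  have hstep : ∀ n < N, l ≤ d (n + 1) - d n := fun n hn => (h n hn).1
  have hmono : ∀ m n, n + m ≤ N → d n ≤ d (n + m) := by
    intro m
    induction m with
    | zero => intro n _; simp
    | succ m ih =>
      intro n hn
      have h1 := ih n (by omega)
      have h2 := hstep (n + m) (by omega)
      rw [← add_assoc]
      linarith
  have hmono' : ∀ m n, m ≤ n → n ≤ N → d m ≤ d n := fun m n hmn hn => by
    have := hmono (n - m) m (by omega)
    rwa [Nat.add_sub_cancel' hmn] at this
  have hup : ∀ m, m ≤ N → d m ≤ d 0 + m * (K * l) := by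
    intro m
    induction m with
    | zero => intro _; simp
    | succ m ih =>
      intro hm
      have h1 := ih (by omega)
      have h2 := (h m (by omega)).2
      have h3 : d (m + 1) - d m ≤ K * l := h2
      push_cast
      linarith
  -- The indices are grouped by the integer part `v` of the phase difference `d n`. Those with `d n`
  -- within `δ` of `v` or `v + 1` are counted trivially, `d` having steps at least `l`; the others
  -- form an interval on which the Kusmin–Landau bound applies.
  have hfib : ∀ v : ℤ, ‖∑ n ∈ (Finset.range N).filter (fun n => ⌊d n⌋ = v), e (g n)‖ ≤
      2 * (δ / l + 1) + 1 / δ ^ 2 := by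
    intro v
    set F := (Finset.range N).filter (fun n => ⌊d n⌋ = v) with hF
    have hFm : ∀ n ∈ F, n < N ∧ v ≤ d n ∧ d n < v + 1 := by
      intro n hn
      rw [hF, Finset.mem_filter, Finset.mem_range, Int.floor_eq_iff] at hn
      exact ⟨hn.1, hn.2⟩
    rw [← Finset.sum_filter_add_sum_filter_not F (fun n => d n < v + δ),
      ← Finset.sum_filter_add_sum_filter_not (F.filter (fun n => ¬ d n < v + δ))
        (fun n => v + 1 - δ < d n)]
    have A1 : ‖∑ n ∈ F.filter (fun n => d n < v + δ), e (g n)‖ ≤ δ / l + 1 := by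
      refine (norm_sum_e_le_card _ _).trans ?_
      refine card_le_of_forall_mem_Icc (x := v) hl hstep hδ.le _ ?_ ?_
      · intro n hn
        exact (hFm n (Finset.mem_filter.1 hn).1).1
      · intro n hn
        exact ⟨(hFm n (Finset.mem_filter.1 hn).1).2.1, (Finset.mem_filter.1 hn).2.le⟩
    have A2 : ‖∑ n ∈ (F.filter (fun n => ¬ d n < v + δ)).filter (fun n => v + 1 - δ < d n),
        e (g n)‖ ≤ δ / l + 1 := by
      refine (norm_sum_e_le_card _ _).trans ?_
      refine card_le_of_forall_mem_Icc (x := v + 1 - δ) hl hstep hδ.le _ ?_ ?_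
      · intro n hn
        exact (hFm n (Finset.mem_filter.1 (Finset.mem_filter.1 hn).1).1).1
      · intro n hn
        refine ⟨(Finset.mem_filter.1 hn).2.le, ?_⟩
        linarith [(hFm n (Finset.mem_filter.1 (Finset.mem_filter.1 hn).1).1).2.2]
    have A3 : ‖∑ n ∈ (F.filter (fun n => ¬ d n < v + δ)).filter (fun n => ¬ v + 1 - δ < d n),
        e (g n)‖ ≤ 1 / δ ^ 2 := by
      set G := (F.filter (fun n => ¬ d n < v + δ)).filter (fun n => ¬ v + 1 - δ < d n) with hG
      have hGm : ∀ n, n ∈ G ↔ n < N ∧ v + δ ≤ d n ∧ d n ≤ v + 1 - δ := by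
        intro n
        simp only [hG, hF, Finset.mem_filter, Finset.mem_range, Int.floor_eq_iff, not_lt]
        constructor
        · rintro ⟨⟨⟨a, b⟩, c⟩, d⟩; exact ⟨a, c, d⟩
        · rintro ⟨a, c, d⟩; exact ⟨⟨⟨a, by linarith, by linarith⟩, c⟩, d⟩
      obtain ⟨a, b, hab⟩ := exists_eq_Ico_of_ordConnected G (by
        intro x hx y hy z hxz hzy
        rw [hGm] at hx hy ⊢
        refine ⟨by omega, ?_, ?_⟩
        · exact hx.2.1.trans (hmono' _ _ hxz (by omega))
        · exact (hmono' _ _ hzy (by omega)).trans hy.2.2)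
      rw [hab] at hGm ⊢
      refine norm_sum_e_le_of_diff_mem g a b hδ hδ' v (fun n hn => ((hGm n).1 hn).2)
        (fun n hn => ?_)
      have := (h n ((hGm n).1 hn).1).1
      linarith
    refine (norm_add_le _ _).trans ?_
    have := norm_add_le
      (∑ n ∈ (F.filter (fun n => ¬ d n < v + δ)).filter (fun n => v + 1 - δ < d n), e (g n))
      (∑ n ∈ (F.filter (fun n => ¬ d n < v + δ)).filter (fun n => ¬ v + 1 - δ < d n), e (g n))
    linarith
  rcases Nat.eq_zero_or_pos N with rfl | hN
  · simp; positivity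
  -- The total rise of `d` is at most `N K l`, which bounds the number of groups by `N K l + 2`.
  have hmaps : ∀ n ∈ Finset.range N, ⌊d n⌋ ∈ Finset.Icc ⌊d 0⌋ ⌊d N⌋ := by
    intro n hn
    rw [Finset.mem_range] at hn
    exact Finset.mem_Icc.2 ⟨Int.floor_le_floor (hmono' 0 n (by omega) hn.le),
      Int.floor_le_floor (hmono' n N hn.le le_rfl)⟩
  rw [← Finset.sum_fiberwise_of_maps_to hmaps]
  refine (norm_sum_le _ _).trans ((Finset.sum_le_sum fun v _ => hfib v).trans ?_)
  rw [Finset.sum_const, nsmul_eq_mul]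
  refine mul_le_mul_of_nonneg_right ?_ (by positivity)
  rw [Int.card_Icc]
  have hle : ⌊d 0⌋ ≤ ⌊d N⌋ := Int.floor_le_floor (hmono' 0 N (by omega) le_rfl)
  have : (((⌊d N⌋ + 1 - ⌊d 0⌋).toNat : ℤ) : ℝ) = (⌊d N⌋ : ℝ) + 1 - ⌊d 0⌋ := by
    rw [Int.toNat_of_nonneg (by omega)]; push_cast; ring
  have h5 := hup N le_rfl
  have h6 := Int.floor_le (d N)
  have h7 := Int.lt_floor_add_one (d 0)
  have h8 : (((⌊d N⌋ + 1 - ⌊d 0⌋).toNat : ℕ) : ℝ) = (⌊d N⌋ : ℝ) + 1 - ⌊d 0⌋ := by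
    rw [← this]; norm_cast
  rw [h8]
  linarith

/-- The second difference test. -/
lemma norm_sum_e_le_of_second_diff (g : ℕ → ℝ) (N : ℕ) {l K : ℝ} (hl : 0 < l)
    (hl' : l ≤ 1 / 8) (hK : 0 ≤ K)
    (h : ∀ n < N, l ≤ (g (n + 2) - g (n + 1)) - (g (n + 1) - g n) ∧
      (g (n + 2) - g (n + 1)) - (g (n + 1) - g n) ≤ K * l) :
    ‖∑ n ∈ Finset.range N, e (g n)‖ ≤
      5 * K * N * l ^ (1 / 3 : ℝ) + 10 * l ^ (-(2 / 3) : ℝ) := by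
  -- The choice `δ = l ^ (1/3)` balances `δ / l` against `1 / δ ^ 2`; the condition `l ≤ 1 / 8` is
  -- exactly `δ ≤ 1 / 2`.
  have hδ : 0 < l ^ (1 / 3 : ℝ) := by positivity
  have hδ' : l ^ (1 / 3 : ℝ) ≤ 1 / 2 := by
    calc l ^ (1 / 3 : ℝ) ≤ (1 / 8 : ℝ) ^ (1 / 3 : ℝ) := by gcongr
      _ = ((1 / 2 : ℝ) ^ (3 : ℝ)) ^ (1 / 3 : ℝ) := by norm_num
      _ = 1 / 2 := by rw [← Real.rpow_mul (by norm_num)]; norm_num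
  have h1 := norm_sum_e_le_of_second_diff_aux g N hl hδ hδ' hK h
  have e1 : l ^ (1 / 3 : ℝ) / l = l ^ (-(2 / 3) : ℝ) := by
    rw [← Real.rpow_sub_one hl.ne']; norm_num
  have e2 : 1 / (l ^ (1 / 3 : ℝ)) ^ 2 = l ^ (-(2 / 3) : ℝ) := by
    rw [← Real.rpow_natCast, ← Real.rpow_mul hl.le, one_div, ← Real.rpow_neg hl.le]; norm_num
  have e3 : (1 : ℝ) ≤ l ^ (-(2 / 3) : ℝ) :=
    Real.one_le_rpow_of_pos_of_le_one_of_nonpos hl (by linarith) (by norm_num)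
  have e4 : l * l ^ (-(2 / 3) : ℝ) = l ^ (1 / 3 : ℝ) := by
    rw [← Real.rpow_one_add' hl.le (by norm_num)]; norm_num
  rw [e1, e2] at h1
  refine h1.trans ?_
  have e5 : 0 ≤ N * (K * l) + 2 := by positivity
  calc _ ≤ (N * (K * l) + 2) * (5 * l ^ (-(2 / 3) : ℝ)) :=
        mul_le_mul_of_nonneg_left (by linarith) e5
    _ = 5 * K * N * (l * l ^ (-(2 / 3) : ℝ)) + 10 * l ^ (-(2 / 3) : ℝ) := by ring
    _ = _ := by rw [e4]

/-! ### Van der Corput's inequality -/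

/-- The van der Corput inequality for unimodular sequences, in terms of a uniform bound for the
correlations. -/
lemma norm_sum_sq_le_of_correlation_le (z : ℕ → ℂ) (hz : ∀ n, ‖z n‖ ≤ 1) (N H : ℕ) (hH : 0 < H)
    {B : ℝ} (hB : ∀ r, 1 ≤ r → r < H →
      ‖∑ n ∈ Finset.range (N - r), z (n + r) * starRingEnd ℂ (z n)‖ ≤ B) (hB0 : 0 ≤ B) :
    ‖∑ n ∈ Finset.range N, z n‖ ^ 2 ≤ (N + H) * (N / H + B) := by
  -- `Z h` is the sequence shifted by `h` and extended by zero, so all `H` shifts live on `[0, N +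
  -- H)` and have the same sum. Cauchy–Schwarz over `t` then produces correlations that depend only
  -- on the difference of two shifts.
  set Z : ℕ → ℕ → ℂ := fun h t => if h ≤ t ∧ t < N + h then z (t - h) else 0 with hZ
  have hsum : ∀ h < H, ∑ t ∈ Finset.range (N + H), Z h t = ∑ n ∈ Finset.range N, z n := by
    intro h hh
    simp only [hZ]
    rw [← Finset.sum_filter]
    symm
    refine Finset.sum_bij (fun n _ => n + h) ?_ ?_ ?_ ?_
    · intro n hn
      simp only [Finset.mem_filter, Finset.mem_range] at hn ⊢
      omega
    · intro a _ b _ hab; omega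
    · intro t ht
      simp only [Finset.mem_filter, Finset.mem_range] at ht
      exact ⟨t - h, by simp only [Finset.mem_range]; omega, by omega⟩
    · intro n _; simp
  have hcorr : ∀ h < H, ∀ r, h + r < H →
      ∑ t ∈ Finset.range (N + H), Z h t * starRingEnd ℂ (Z (h + r) t) =
      ∑ n ∈ Finset.range (N - r), z (n + r) * starRingEnd ℂ (z n) := by
    intro h hh r hr
    have : ∀ t, Z h t * starRingEnd ℂ (Z (h + r) t) =
        if h + r ≤ t ∧ t < N + h then z (t - h) * starRingEnd ℂ (z (t - (h + r))) else 0 := by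
      intro t
      simp only [hZ]
      split_ifs <;> first | rfl | (exfalso; omega) | simp
    simp only [this]
    rw [← Finset.sum_filter]
    symm
    refine Finset.sum_bij (fun n _ => n + (h + r)) ?_ ?_ ?_ ?_
    · intro n hn
      simp only [Finset.mem_filter, Finset.mem_range] at hn ⊢
      omega
    · intro a _ b _ hab; omega
    · intro t ht
      simp only [Finset.mem_filter, Finset.mem_range] at ht
      exact ⟨t - (h + r), by simp only [Finset.mem_range]; omega, by omega⟩
    · intro n _
      have h1 : n + (h + r) - h = n + r := by omega
      have h2 : n + (h + r) - (h + r) = n := by omega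
      rw [h1, h2]
  have hdiag : ∀ h h', h < H → h' < H →
      ‖∑ t ∈ Finset.range (N + H), Z h t * starRingEnd ℂ (Z h' t)‖ ≤
        (if h = h' then (N : ℝ) else 0) + B := by
    intro h h' hh hh'
    rcases lt_trichotomy h h' with hlt | rfl | hlt
    · obtain ⟨r, rfl⟩ : ∃ r, h' = h + r := ⟨h' - h, by omega⟩
      rw [hcorr h hh r hh', if_neg (by omega), zero_add]
      exact hB r (by omega) (by omega)
    · have := hcorr h hh 0 (by omega)
      rw [add_zero] at this
      rw [this, if_pos rfl]
      refine (norm_sum_le _ _).trans ?_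
      refine le_trans (Finset.sum_le_card_nsmul _ _ 1 ?_) ?_
      · intro n _
        rw [norm_mul, RCLike.norm_conj]
        exact mul_le_one₀ (hz _) (norm_nonneg _) (hz _)
      · simp [hB0]
    · obtain ⟨r, rfl⟩ : ∃ r, h = h' + r := ⟨h - h', by omega⟩
      have : ∑ t ∈ Finset.range (N + H), Z (h' + r) t * starRingEnd ℂ (Z h' t) =
          starRingEnd ℂ (∑ t ∈ Finset.range (N + H), Z h' t * starRingEnd ℂ (Z (h' + r) t)) := by
        rw [map_sum]
        refine Finset.sum_congr rfl fun t _ => ?_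
        rw [map_mul, Complex.conj_conj, mul_comm]
      rw [this, RCLike.norm_conj, hcorr h' hh' r hh, if_neg (by omega), zero_add]
      exact hB r (by omega) (by omega)
  have hHS : (H : ℂ) * ∑ n ∈ Finset.range N, z n =
      ∑ t ∈ Finset.range (N + H), ∑ h ∈ Finset.range H, Z h t := by
    rw [Finset.sum_comm, Finset.sum_congr rfl fun h hh => hsum h (Finset.mem_range.1 hh)]
    simp
  have hsq : (H : ℝ) ^ 2 * ‖∑ n ∈ Finset.range N, z n‖ ^ 2 ≤
      (N + H) * ∑ t ∈ Finset.range (N + H), ‖∑ h ∈ Finset.range H, Z h t‖ ^ 2 := by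
    have h1 : (H : ℝ) * ‖∑ n ∈ Finset.range N, z n‖ ≤
        ∑ t ∈ Finset.range (N + H), ‖∑ h ∈ Finset.range H, Z h t‖ := by
      have : (H : ℝ) * ‖∑ n ∈ Finset.range N, z n‖ = ‖(H : ℂ) * ∑ n ∈ Finset.range N, z n‖ := by
        rw [norm_mul, Complex.norm_natCast]
      rw [this, hHS]
      exact norm_sum_le _ _
    rw [← mul_pow]
    refine (pow_le_pow_left₀ (by positivity) h1 2).trans ?_
    have := sq_sum_le_card_mul_sum_sq (s := Finset.range (N + H))
      (f := fun t => ‖∑ h ∈ Finset.range H, Z h t‖)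
    rw [Finset.card_range] at this
    push_cast at this
    exact this
  have hexp : ∑ t ∈ Finset.range (N + H), ‖∑ h ∈ Finset.range H, Z h t‖ ^ 2 ≤
      H * N + (H : ℝ) ^ 2 * B := by
    have h1 : ((∑ t ∈ Finset.range (N + H), ‖∑ h ∈ Finset.range H, Z h t‖ ^ 2 : ℝ) : ℂ) =
        ∑ h ∈ Finset.range H, ∑ h' ∈ Finset.range H,
          ∑ t ∈ Finset.range (N + H), Z h t * starRingEnd ℂ (Z h' t) := by
      push_cast
      have : ∀ t, ((‖∑ h ∈ Finset.range H, Z h t‖ : ℂ)) ^ 2 =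
          ∑ h ∈ Finset.range H, ∑ h' ∈ Finset.range H, Z h t * starRingEnd ℂ (Z h' t) := by
        intro t
        rw [← Complex.mul_conj', map_sum, Finset.sum_mul_sum]
      simp only [this]
      rw [Finset.sum_comm]
      refine Finset.sum_congr rfl fun h _ => ?_
      rw [Finset.sum_comm]
    have h2 : ∑ t ∈ Finset.range (N + H), ‖∑ h ∈ Finset.range H, Z h t‖ ^ 2 =
        ‖((∑ t ∈ Finset.range (N + H), ‖∑ h ∈ Finset.range H, Z h t‖ ^ 2 : ℝ) : ℂ)‖ := by
      rw [Complex.norm_real, Real.norm_of_nonneg (by positivity)]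
    rw [h2, h1]
    calc _ ≤ ∑ h ∈ Finset.range H, ∑ h' ∈ Finset.range H,
          ((if h = h' then (N : ℝ) else 0) + B) := by
          refine (norm_sum_le _ _).trans (Finset.sum_le_sum fun h hh => ?_)
          refine (norm_sum_le _ _).trans (Finset.sum_le_sum fun h' hh' => ?_)
          exact hdiag h h' (Finset.mem_range.1 hh) (Finset.mem_range.1 hh')
      _ = _ := by
          have : ∀ h ∈ Finset.range H, ∑ h' ∈ Finset.range H,
              ((if h = h' then (N : ℝ) else 0) + B) = N + H * B := by
            intro h hh
            rw [Finset.sum_add_distrib, Finset.sum_ite_eq, if_pos hh]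
            simp
          rw [Finset.sum_congr rfl this]
          simp
          ring
  have hHpos : (0 : ℝ) < H := by exact_mod_cast hH
  have hfin : (H : ℝ) ^ 2 * ‖∑ n ∈ Finset.range N, z n‖ ^ 2 ≤
      (H : ℝ) ^ 2 * ((N + H) * (N / H + B)) := by
    refine hsq.trans ((mul_le_mul_of_nonneg_left hexp (by positivity)).trans (le_of_eq ?_))
    field_simp
  exact le_of_mul_le_mul_left hfin (by positivity)

/-! ### Iterated differences of a power function -/

/-- Iterated forward differences with the given list of shifts. -/
def iterDiff : List ℕ → (ℝ → ℝ) → ℝ → ℝ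
  | [], f => f
  | h :: hs, f => fun x => iterDiff hs f (x + h) - iterDiff hs f x

/-- Differencing commutes with differentiation, so the derivative has the same shape with exponent
`c - 1`. This is what lets the mean value theorem be iterated. -/
lemma hasDerivAt_iterDiff_rpow (c : ℝ) (hs : List ℕ) {x : ℝ} (hx : 0 < x) :
    HasDerivAt (iterDiff hs (fun y => y ^ c)) (c * iterDiff hs (fun y => y ^ (c - 1)) x) x := by
  induction hs generalizing x with
  | nil =>
    simpa [iterDiff] using Real.hasDerivAt_rpow_const (p := c) (Or.inl hx.ne')
  | cons h hs ih =>
    have h1 := ih (x := x + h) (by positivity)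
    have h2 := (h1.comp_add_const x (h : ℝ)).sub (ih hx)
    refine HasDerivAt.congr_deriv (f := iterDiff (h :: hs) (fun y => y ^ c)) h2 ?_
    simp only [iterDiff]
    ring

lemma eval_descPochhammer_succ (n : ℕ) (c : ℝ) :
    (descPochhammer ℝ (n + 1)).eval c = c * (descPochhammer ℝ n).eval (c - 1) := by
  simp [descPochhammer_succ_left]

/-- The factors are `c`, `c - 1`, …, none of which is zero. This is the point where non-integrality
of `c` is indispensable: it keeps the leading constant of every iterated difference away from zero.
-/
lemma eval_descPochhammer_ne_zero (n : ℕ) {c : ℝ} (hc : ∀ m : ℤ, c ≠ m) :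
    (descPochhammer ℝ n).eval c ≠ 0 := by
  induction n generalizing c with
  | zero => simp
  | succ n ih =>
    rw [eval_descPochhammer_succ]
    refine mul_ne_zero (by simpa using hc 0) (ih fun m h => hc (m + 1) ?_)
    push_cast
    linarith

/-- The mean value theorem for iterated differences of a power function. -/
lemma exists_iterDiff_rpow_eq (hs : List ℕ) (c : ℝ) {x : ℝ} (hx : 0 < x) :
    ∃ ξ, x ≤ ξ ∧ ξ ≤ x + hs.sum ∧ iterDiff hs (fun y => y ^ c) x =
      hs.prod * (descPochhammer ℝ hs.length).eval c * ξ ^ (c - hs.length) := by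
  induction hs generalizing c x with
  | nil => exact ⟨x, le_rfl, by simp, by simp [iterDiff]⟩
  | cons h hs ih =>
    -- A zero shift annihilates both sides; it is set apart because the mean value theorem needs a
    -- nondegenerate interval.
    rcases Nat.eq_zero_or_pos h with rfl | hpos
    · exact ⟨x, le_rfl, le_add_of_nonneg_right (Nat.cast_nonneg _), by simp [iterDiff]⟩
    have hh : (0 : ℝ) < h := by exact_mod_cast hpos
    obtain ⟨y, hy, hyeq⟩ := exists_hasDerivAt_eq_slope (iterDiff hs (fun y => y ^ c))
      (fun x => c * iterDiff hs (fun y => y ^ (c - 1)) x) (a := x) (b := x + h) (by linarith)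
      (fun z hz => (hasDerivAt_iterDiff_rpow c hs
        (lt_of_lt_of_le hx hz.1)).continuousAt.continuousWithinAt)
      (fun z hz => hasDerivAt_iterDiff_rpow c hs (hx.trans hz.1))
    obtain ⟨ξ, h1, h2, h3⟩ := ih (c - 1) (x := y) (hx.trans hy.1)
    refine ⟨ξ, hy.1.le.trans h1, ?_, ?_⟩
    · rw [List.sum_cons, Nat.cast_add]
      linarith [hy.2]
    · have : iterDiff (h :: hs) (fun y => y ^ c) x =
          h * (c * iterDiff hs (fun y => y ^ (c - 1)) y) := by
        rw [hyeq, add_sub_cancel_left, mul_div_cancel₀ _ hh.ne']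
        rfl
      rw [this, h3, List.prod_cons, List.length_cons, eval_descPochhammer_succ, Nat.cast_mul,
        Nat.cast_add, Nat.cast_one]
      have : c - 1 - (hs.length : ℝ) = c - (hs.length + 1) := by ring
      rw [this]
      ring

lemma rpow_mem_of_mem {t J s : ℝ} (h1 : 1 ≤ t) (h2 : t ≤ J) :
    (J ^ |s|)⁻¹ ≤ t ^ s ∧ t ^ s ≤ J ^ |s| := by
  have ht : 0 < t := by linarith
  have hJ : 0 < J := by linarith
  constructor
  · rw [← Real.rpow_neg hJ.le]
    calc J ^ (-|s|) ≤ t ^ (-|s|) := Real.rpow_le_rpow_of_nonpos ht h2 (by simp)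
      _ ≤ t ^ s := Real.rpow_le_rpow_of_exponent_le h1 (neg_abs_le s)
  · calc t ^ s ≤ t ^ |s| := Real.rpow_le_rpow_of_exponent_le h1 (le_abs_self s)
      _ ≤ J ^ |s| := Real.rpow_le_rpow ht.le h2 (abs_nonneg s)

lemma list_prod_le_pow (hs : List ℕ) {B : ℝ} (hB : ∀ h ∈ hs, (h : ℝ) ≤ B) :
    (hs.prod : ℝ) ≤ B ^ hs.length := by
  induction hs with
  | nil => simp
  | cons h hs ih =>
    rw [List.prod_cons, List.length_cons, pow_succ', Nat.cast_mul]
    have hB0 : 0 ≤ B := (Nat.cast_nonneg h).trans (hB h (by simp))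
    exact mul_le_mul (hB h (by simp)) (ih fun x hx => hB x (by simp [hx])) (by positivity) hB0

lemma list_sum_le_mul (hs : List ℕ) {B : ℝ} (hB : ∀ h ∈ hs, (h : ℝ) ≤ B) :
    (hs.sum : ℝ) ≤ hs.length * B := by
  induction hs with
  | nil => simp
  | cons h hs ih =>
    rw [List.sum_cons, List.length_cons, Nat.cast_add, Nat.cast_add, Nat.cast_one]
    linarith [hB h (by simp), ih fun x hx => hB x (by simp [hx])]

lemma norm_sum_e_neg (s : Finset ℕ) (g : ℕ → ℝ) :
    ‖∑ n ∈ s, e (-g n)‖ = ‖∑ n ∈ s, e (g n)‖ := by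
  simp only [e_neg]
  rw [← map_sum, RCLike.norm_conj]

/-- The second difference test when the second differences have constant sign `σ`. -/
lemma norm_sum_e_le_of_signed_second_diff (g : ℕ → ℝ) (N : ℕ) {l K σ : ℝ} (hσ : σ = 1 ∨ σ = -1)
    (hl : 0 < l) (hl' : l ≤ 1 / 8) (hK : 0 ≤ K)
    (h : ∀ n < N, l ≤ σ * ((g (n + 2) - g (n + 1)) - (g (n + 1) - g n)) ∧
      σ * ((g (n + 2) - g (n + 1)) - (g (n + 1) - g n)) ≤ K * l) :
    ‖∑ n ∈ Finset.range N, e (g n)‖ ≤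
      5 * K * N * l ^ (1 / 3 : ℝ) + 10 * l ^ (-(2 / 3) : ℝ) := by
  rcases hσ with rfl | rfl
  · simp only [one_mul] at h
    exact norm_sum_e_le_of_second_diff g N hl hl' hK h
  · rw [← norm_sum_e_neg]
    refine norm_sum_e_le_of_second_diff (fun n => -g n) N hl hl' hK fun n hn => ?_
    obtain ⟨h1, h2⟩ := h n hn
    constructor <;> linarith

/-! ### Power saving for exponential sums with phase β n ^ c -/

/-- Sums over `[M, 2M)` of the phase `β Δ_{hs} x ^ c` for a list of `j` small shifts. -/
lemma norm_sum_e_iterDiff_le {c : ℝ} (hc : ∀ m : ℤ, c ≠ m) (j : ℕ) :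
    ∃ C : ℝ, 0 ≤ C ∧ ∀ (M : ℕ) (β : ℝ), 1 ≤ M → (M : ℝ) ^ (j + 4 / 5 : ℝ) ≤ |β| * M ^ c →
      |β| * M ^ c ≤ (M : ℝ) ^ (j + 9 / 5 : ℝ) → ∀ hs : List ℕ, hs.length = j →
      (∀ h ∈ hs, 1 ≤ h ∧ (h : ℝ) ≤ (M : ℝ) ^ (1 / (20 * (j + 1)) : ℝ)) →
      ∀ a N : ℕ, M ≤ a → a + N ≤ 2 * M →
      ‖∑ n ∈ Finset.range N, e (β * iterDiff hs (fun y => y ^ c) ((a + n : ℕ) : ℝ))‖ ≤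
        C * (M : ℝ) ^ (1 - 1 / 20 : ℝ) := by
  set D := (descPochhammer ℝ (j + 2)).eval c with hD
  have hD0 : D ≠ 0 := eval_descPochhammer_ne_zero _ hc
  set P := |D| with hP
  have hP0 : 0 < P := abs_pos.2 hD0
  set s : ℝ := c - (j + 2) with hs_def
  -- The intermediate point `ξ` of the mean value theorem satisfies `M ≤ ξ ≤ J M`: the base point
  -- plus the two unit shifts is at most `4 M`, and the `j` other shifts add at most `j M`. Hence
  -- `(ξ / M) ^ s` lies between `Q⁻¹` and `Q`.
  set J : ℝ := j + 4 with hJ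
  have hJ1 : 1 ≤ J := by have : (0 : ℝ) ≤ j := Nat.cast_nonneg j; linarith
  set Q := J ^ |s| with hQ
  have hQ1 : 1 ≤ Q := Real.one_le_rpow hJ1 (abs_nonneg s)
  have hQ0 : 0 < Q := by linarith
  set R := P / Q with hR
  have hR0 : 0 < R := by positivity
  -- The first two summands come from the second difference test; the last absorbs the bounded range
  -- of `M` in which `l > 1 / 8`.
  refine ⟨5 * Q ^ 2 * R ^ (1 / 3 : ℝ) + 10 * R ^ (-(2 / 3) : ℝ) + (8 * R) ^ (1 / 3 : ℝ),
    by positivity, ?_⟩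
  intro M β hM hlo hhi hs hlen hsb a N haM hN
  have hM1 : (1 : ℝ) ≤ M := by exact_mod_cast hM
  have hM0 : (0 : ℝ) < M := by linarith
  have hβ : β ≠ 0 := by
    rintro rfl
    have : (0 : ℝ) < (M : ℝ) ^ (j + 4 / 5 : ℝ) := by positivity
    simp at hlo
    linarith
  have hprod1 : (1 : ℝ) ≤ hs.prod := by
    exact_mod_cast Nat.one_le_iff_ne_zero.2
      (List.prod_ne_zero (fun h0 => by have := (hsb 0 h0).1; omega))
  have hprod2 : (hs.prod : ℝ) ≤ (M : ℝ) ^ (1 / 20 : ℝ) := by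
    refine (list_prod_le_pow hs fun h hh => (hsb h hh).2).trans ?_
    rw [hlen, ← Real.rpow_mul_natCast hM0.le]
    refine Real.rpow_le_rpow_of_exponent_le hM1 ?_
    rw [div_mul_eq_mul_div, div_le_div_iff₀ (by positivity) (by norm_num)]
    linarith
  have hsum : (hs.sum : ℝ) ≤ j * M := by
    have := list_sum_le_mul hs (B := M) fun h hh => (hsb h hh).2.trans (by
      calc (M : ℝ) ^ (1 / (20 * (j + 1)) : ℝ) ≤ (M : ℝ) ^ (1 : ℝ) := by
            refine Real.rpow_le_rpow_of_exponent_le hM1 ?_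
            rw [div_le_one (by positivity)]
            linarith [(Nat.cast_nonneg j : (0 : ℝ) ≤ j)]
        _ = M := Real.rpow_one _)
    rwa [hlen] at this
  have hMs : (M : ℝ) ^ s = (M : ℝ) ^ c * (M : ℝ) ^ (-(j + 2) : ℝ) := by
    rw [← Real.rpow_add hM0]; congr 1
  set l := |β| * hs.prod * P * (M : ℝ) ^ s / Q with hl
  have hl_eq : l = R * (|β| * (M : ℝ) ^ c) * (M : ℝ) ^ (-(j + 2) : ℝ) * hs.prod := by
    rw [hl, hMs, hR]; ring
  have hl0 : 0 < l := by
    have : 0 < |β| := abs_pos.2 hβ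
    have : (0 : ℝ) < hs.prod := by linarith
    positivity
  -- The product of the shifts lies in `[1, M ^ (1/20)]` and `|β| M ^ c` in `[M ^ (j + 4/5), M ^ (j
  -- + 9/5)]`, so `l` is between constant multiples of `M ^ (-6/5)` and `M ^ (-3/20)`. The two terms
  -- `M l ^ (1/3)` and `l ^ (-2/3)` of the test are then of order at most `M ^ (19/20)` and `M ^
  -- (4/5)`.
  have hl_lo : R * (M : ℝ) ^ (-(6 / 5) : ℝ) ≤ l := by
    rw [hl_eq]
    calc R * (M : ℝ) ^ (-(6 / 5) : ℝ)
        = R * (M : ℝ) ^ (j + 4 / 5 : ℝ) * (M : ℝ) ^ (-(j + 2) : ℝ) * 1 := by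
          rw [mul_one, mul_assoc, ← Real.rpow_add hM0]; congr 2; ring
      _ ≤ _ := by gcongr
  have hl_hi : l ≤ R * (M : ℝ) ^ (-(3 / 20) : ℝ) := by
    rw [hl_eq]
    calc _ ≤ R * (M : ℝ) ^ (j + 9 / 5 : ℝ) * (M : ℝ) ^ (-(j + 2) : ℝ) * (M : ℝ) ^ (1 / 20 : ℝ) := by
          gcongr
      _ = _ := by
          rw [mul_assoc, mul_assoc, ← Real.rpow_add hM0, ← Real.rpow_add hM0]; congr 2; ring
  have hNM : (N : ℝ) ≤ M := by exact_mod_cast (by omega : N ≤ M)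
  have hpow0 : (0 : ℝ) < (M : ℝ) ^ (1 - 1 / 20 : ℝ) := by positivity
  have hr1 : 0 < R ^ (1 / 3 : ℝ) := by positivity
  have hr2 : 0 < R ^ (-(2 / 3) : ℝ) := by positivity
  rcases le_or_gt l (1 / 8) with hl8 | hl8
  · -- the second difference test applies
    set σ : ℝ := ((SignType.sign (β * D) : SignType) : ℝ) with hσ
    have hσ' : σ = 1 ∨ σ = -1 := by
      rcases lt_or_gt_of_ne (mul_ne_zero hβ hD0) with h | h
      · right; rw [hσ, sign_neg h]; simp
      · left; rw [hσ, sign_pos h]; simp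
    have hσabs : σ * (β * D) = |β| * P := by
      rw [hσ, sign_mul_self, abs_mul]
    have key := norm_sum_e_le_of_signed_second_diff
      (fun n => β * iterDiff hs (fun y => y ^ c) ((a + n : ℕ) : ℝ)) N (K := Q ^ 2) hσ' hl0 hl8
      (by positivity) (by
        intro n hn
        have ha : (M : ℝ) ≤ ((a + n : ℕ) : ℝ) := by exact_mod_cast (by omega : M ≤ a + n)
        have ha2 : ((a + n : ℕ) : ℝ) + 2 ≤ 4 * M := by
          exact_mod_cast (by omega : a + n + 2 ≤ 4 * M)
        obtain ⟨ξ, h1, h2, h3⟩ := exists_iterDiff_rpow_eq (1 :: 1 :: hs) c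
          (x := ((a + n : ℕ) : ℝ)) (by linarith)
        have hdd : β * iterDiff hs (fun y => y ^ c) ((a + (n + 2) : ℕ) : ℝ) -
            β * iterDiff hs (fun y => y ^ c) ((a + (n + 1) : ℕ) : ℝ) -
            (β * iterDiff hs (fun y => y ^ c) ((a + (n + 1) : ℕ) : ℝ) -
              β * iterDiff hs (fun y => y ^ c) ((a + n : ℕ) : ℝ)) =
            β * iterDiff (1 :: 1 :: hs) (fun y => y ^ c) ((a + n : ℕ) : ℝ) := by
          simp only [iterDiff]
          have e1 : ((a + (n + 2) : ℕ) : ℝ) = ((a + n : ℕ) : ℝ) + ((1 : ℕ) : ℝ) + ((1 : ℕ) : ℝ) := by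
            push_cast; ring
          have e2 : ((a + (n + 1) : ℕ) : ℝ) = ((a + n : ℕ) : ℝ) + ((1 : ℕ) : ℝ) := by
            push_cast; ring
          rw [e1, e2]
          ring
        have hlen2 : (1 :: 1 :: hs).length = j + 2 := by simp [hlen]
        have hξ : 0 < ξ := by linarith
        have hsum2 : ξ ≤ J * M := by
          refine h2.trans ?_
          simp only [List.sum_cons, Nat.cast_add, Nat.cast_one] at ha2 ⊢
          rw [hJ]
          linarith
        have ht1 : 1 ≤ ξ / M := (one_le_div hM0).2 (ha.trans h1)
        have ht2 : ξ / M ≤ J := (div_le_iff₀ hM0).2 hsum2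
        have hξs : ξ ^ s = (M : ℝ) ^ s * (ξ / M) ^ s := by
          rw [← Real.mul_rpow hM0.le (by positivity)]; congr 1; field_simp
        obtain ⟨hq1, hq2⟩ := rpow_mem_of_mem (s := s) ht1 ht2
        have hval : σ * (β * iterDiff (1 :: 1 :: hs) (fun y => y ^ c) ((a + n : ℕ) : ℝ)) =
            l * Q * (ξ / M) ^ s := by
          rw [h3, hlen2]
          simp only [List.prod_cons, one_mul]
          have : c - ((j + 2 : ℕ) : ℝ) = s := by push_cast; rfl
          rw [this, ← hD, hξs]
          calc _ = (σ * (β * D)) * hs.prod * ((M : ℝ) ^ s * (ξ / M) ^ s) := by ring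
            _ = _ := by rw [hσabs, hl]; field_simp
        rw [hdd, hval]
        constructor
        · calc l = l * Q * Q⁻¹ := by field_simp
            _ ≤ _ := by gcongr
        · calc l * Q * (ξ / M) ^ s ≤ l * Q * Q := by gcongr
            _ = Q ^ 2 * l := by ring)
    have t1 : l ^ (1 / 3 : ℝ) ≤ R ^ (1 / 3 : ℝ) * (M : ℝ) ^ (-(1 / 20) : ℝ) := by
      calc l ^ (1 / 3 : ℝ) ≤ (R * (M : ℝ) ^ (-(3 / 20) : ℝ)) ^ (1 / 3 : ℝ) := by gcongr
        _ = _ := by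
          rw [Real.mul_rpow hR0.le (by positivity), ← Real.rpow_mul hM0.le]; norm_num
    have t2 : l ^ (-(2 / 3) : ℝ) ≤ R ^ (-(2 / 3) : ℝ) * (M : ℝ) ^ (4 / 5 : ℝ) := by
      calc l ^ (-(2 / 3) : ℝ) ≤ (R * (M : ℝ) ^ (-(6 / 5) : ℝ)) ^ (-(2 / 3) : ℝ) :=
            Real.rpow_le_rpow_of_nonpos (by positivity) hl_lo (by norm_num)
        _ = _ := by
          rw [Real.mul_rpow hR0.le (by positivity), ← Real.rpow_mul hM0.le]; norm_num
    have t3 : (M : ℝ) ^ (4 / 5 : ℝ) ≤ (M : ℝ) ^ (1 - 1 / 20 : ℝ) :=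
      Real.rpow_le_rpow_of_exponent_le hM1 (by norm_num)
    have t4 : (M : ℝ) * (M : ℝ) ^ (-(1 / 20) : ℝ) = (M : ℝ) ^ (1 - 1 / 20 : ℝ) := by
      rw [sub_eq_add_neg, Real.rpow_add hM0, Real.rpow_one]
    refine key.trans ?_
    calc _ ≤ 5 * Q ^ 2 * M * (R ^ (1 / 3 : ℝ) * (M : ℝ) ^ (-(1 / 20) : ℝ)) +
          10 * (R ^ (-(2 / 3) : ℝ) * (M : ℝ) ^ (1 - 1 / 20 : ℝ)) := by
          gcongr
          exact t2.trans (by gcongr)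
      _ = (5 * Q ^ 2 * R ^ (1 / 3 : ℝ) + 10 * R ^ (-(2 / 3) : ℝ)) *
          (M : ℝ) ^ (1 - 1 / 20 : ℝ) := by rw [← t4]; ring
      _ ≤ _ := by
          refine mul_le_mul_of_nonneg_right ?_ hpow0.le
          have : 0 < (8 * R) ^ (1 / 3 : ℝ) := by positivity
          linarith
  · -- here `M` is bounded
    have h1 : (M : ℝ) ^ (3 / 20 : ℝ) ≤ 8 * R := by
      have : (M : ℝ) ^ (-(3 / 20) : ℝ) * (M : ℝ) ^ (3 / 20 : ℝ) = 1 := by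
        rw [← Real.rpow_add hM0]; norm_num
      have h2 : 1 / 8 * (M : ℝ) ^ (3 / 20 : ℝ) ≤
          R * (M : ℝ) ^ (-(3 / 20) : ℝ) * (M : ℝ) ^ (3 / 20 : ℝ) :=
        mul_le_mul_of_nonneg_right (hl8.le.trans hl_hi) (by positivity)
      rw [mul_assoc, this] at h2
      linarith
    have h2 : (M : ℝ) ^ (1 / 20 : ℝ) ≤ (8 * R) ^ (1 / 3 : ℝ) := by
      calc (M : ℝ) ^ (1 / 20 : ℝ) = ((M : ℝ) ^ (3 / 20 : ℝ)) ^ (1 / 3 : ℝ) := by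
            rw [← Real.rpow_mul hM0.le]; norm_num
        _ ≤ _ := by gcongr
    refine (norm_sum_e_le_card _ _).trans ?_
    rw [Finset.card_range]
    calc (N : ℝ) ≤ M := hNM
      _ = (M : ℝ) ^ (1 / 20 : ℝ) * (M : ℝ) ^ (1 - 1 / 20 : ℝ) := by
          rw [← Real.rpow_add hM0]; norm_num
      _ ≤ (8 * R) ^ (1 / 3 : ℝ) * (M : ℝ) ^ (1 - 1 / 20 : ℝ) := by gcongr
      _ ≤ _ := by
          refine mul_le_mul_of_nonneg_right ?_ hpow0.le
          have : 0 ≤ 5 * Q ^ 2 * R ^ (1 / 3 : ℝ) + 10 * R ^ (-(2 / 3) : ℝ) := by positivity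
          linarith

/-- Repeated van der Corput differencing. -/
lemma norm_sum_e_iterDiff_le_of_length {c : ℝ} (hc : ∀ m : ℤ, c ≠ m) (j i : ℕ) :
    ∃ C : ℝ, 0 ≤ C ∧ ∀ (M : ℕ) (β : ℝ), 1 ≤ M → (M : ℝ) ^ (j + 4 / 5 : ℝ) ≤ |β| * M ^ c →
      |β| * M ^ c ≤ (M : ℝ) ^ (j + 9 / 5 : ℝ) → ∀ hs : List ℕ, hs.length + i = j →
      (∀ h ∈ hs, 1 ≤ h ∧ (h : ℝ) ≤ (M : ℝ) ^ (1 / (20 * (j + 1)) : ℝ)) →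
      ∀ a N : ℕ, M ≤ a → a + N ≤ 2 * M →
      ‖∑ n ∈ Finset.range N, e (β * iterDiff hs (fun y => y ^ c) ((a + n : ℕ) : ℝ))‖ ≤
        C * (M : ℝ) ^ (1 - 1 / (20 * (j + 1)) / 2 ^ i : ℝ) := by
  have hj0 : (0 : ℝ) ≤ j := Nat.cast_nonneg j
  induction i with
  | zero =>
    obtain ⟨C, hC, h⟩ := norm_sum_e_iterDiff_le hc j
    refine ⟨C, hC, fun M β hM hlo hhi hs hlen hsb a N haM hN => ?_⟩
    refine (h M β hM hlo hhi hs (by simpa using hlen) hsb a N haM hN).trans ?_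
    refine mul_le_mul_of_nonneg_left ?_ hC
    refine Real.rpow_le_rpow_of_exponent_le (by exact_mod_cast hM) ?_
    rw [pow_zero, div_one]
    have : 1 / (20 * ((j : ℝ) + 1)) ≤ 1 / 20 := by
      rw [div_le_div_iff₀ (by positivity) (by norm_num)]; linarith
    linarith
  | succ i ih =>
    obtain ⟨C, hC, h⟩ := ih
    refine ⟨√(2 * (1 + C)), by positivity, fun M β hM hlo hhi hs hlen hsb a N haM hN => ?_⟩
    have hM1 : (1 : ℝ) ≤ M := by exact_mod_cast hM
    have hM0 : (0 : ℝ) < M := by linarith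
    set η : ℝ := 1 / (20 * (j + 1)) with hη
    have hη0 : 0 < η := by positivity
    have hη1 : η ≤ 1 := by rw [hη, div_le_one (by positivity)]; linarith
    -- Every `r < H` satisfies `r ≤ M ^ η`, so it may join the list of admissible shifts. The
    -- diagonal contributes a saving of `M ^ η`, the correlations one of `M ^ (η / 2 ^ i)`; the
    -- square root halves the weaker exponent.
    set H := ⌈(M : ℝ) ^ η⌉₊ with hH
    have hMη : (0 : ℝ) < (M : ℝ) ^ η := by positivity
    have hHpos : 0 < H := Nat.ceil_pos.2 hMη
    have hHM : H ≤ M := by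
      rw [hH, Nat.ceil_le]
      calc (M : ℝ) ^ η ≤ (M : ℝ) ^ (1 : ℝ) := Real.rpow_le_rpow_of_exponent_le hM1 hη1
        _ = M := Real.rpow_one _
    have hNM : (N : ℝ) ≤ M := by exact_mod_cast (by omega : N ≤ M)
    have hvdc := norm_sum_sq_le_of_correlation_le
      (fun n => e (β * iterDiff hs (fun y => y ^ c) ((a + n : ℕ) : ℝ)))
      (fun n => (norm_e _).le) N H hHpos (B := C * (M : ℝ) ^ (1 - η / 2 ^ i)) (by
        intro r hr1 hrH
        have hr : (r : ℝ) ≤ (M : ℝ) ^ η := (Nat.lt_ceil.1 hrH).le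
        have := h M β hM hlo hhi (r :: hs) (by simp only [List.length_cons]; omega) (by
          intro x hx
          rcases List.mem_cons.1 hx with rfl | hx
          · exact ⟨hr1, hr⟩
          · exact hsb x hx) a (N - r) haM (by omega)
        refine le_trans (le_of_eq ?_) this
        congr 1
        refine Finset.sum_congr rfl fun n _ => ?_
        rw [← e_sub]
        congr 1
        simp only [iterDiff]
        rw [mul_sub]
        congr 3
        push_cast
        ring) (by positivity)
    have hδ : η / 2 ^ i ≤ η := div_le_self hη0.le (one_le_pow₀ (by norm_num))
    have hNH : (N : ℝ) / H ≤ (M : ℝ) ^ (1 - η / 2 ^ i) := by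
      have h1 : (M : ℝ) ^ η ≤ H := Nat.le_ceil _
      calc (N : ℝ) / H ≤ M / (M : ℝ) ^ η := by gcongr
        _ = (M : ℝ) ^ (1 - η) := by rw [Real.rpow_sub hM0, Real.rpow_one]
        _ ≤ _ := Real.rpow_le_rpow_of_exponent_le hM1 (by linarith)
    have hfin : ‖∑ n ∈ Finset.range N, e (β * iterDiff hs (fun y => y ^ c) ((a + n : ℕ) : ℝ))‖ ^ 2
        ≤ (√(2 * (1 + C)) * (M : ℝ) ^ (1 - η / 2 ^ (i + 1))) ^ 2 := by
      refine hvdc.trans ?_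
      have hHM' : (H : ℝ) ≤ M := by exact_mod_cast hHM
      calc ((N : ℝ) + H) * (N / H + C * (M : ℝ) ^ (1 - η / 2 ^ i))
          ≤ (M + M) * ((M : ℝ) ^ (1 - η / 2 ^ i) + C * (M : ℝ) ^ (1 - η / 2 ^ i)) := by gcongr
        _ = 2 * (1 + C) * (M * (M : ℝ) ^ (1 - η / 2 ^ i)) := by ring
        _ = _ := by
          rw [mul_pow, Real.sq_sqrt (by positivity), ← Real.rpow_mul_natCast hM0.le]
          congr 1
          rw [← Real.rpow_one_add' hM0.le]
          · congr 1
            rw [pow_succ]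
            push_cast
            field_simp
            ring
          · have : η / 2 ^ i ≤ 1 := hδ.trans hη1
            linarith
    exact le_of_sq_le_sq hfin (by positivity)

/-- Starting from the empty list of shifts, `j` differencing steps treat the `j`-th size range. Only
finitely many `j` occur, so the worst constant and the least saving serve them all. -/
lemma exists_uniform_power_saving {c : ℝ} (hc : ∀ m : ℤ, c ≠ m) (J : ℕ) :
    ∃ C δ : ℝ, 0 ≤ C ∧ 0 < δ ∧ δ < 1 ∧ ∀ j < J, ∀ (M : ℕ) (β : ℝ), 1 ≤ M →
      (M : ℝ) ^ (j + 4 / 5 : ℝ) ≤ |β| * M ^ c → |β| * M ^ c ≤ (M : ℝ) ^ (j + 9 / 5 : ℝ) →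
      ∀ a N : ℕ, M ≤ a → a + N ≤ 2 * M →
      ‖∑ n ∈ Finset.range N, e (β * ((a + n : ℕ) : ℝ) ^ c)‖ ≤ C * (M : ℝ) ^ (1 - δ) := by
  induction J with
  | zero => exact ⟨0, 1 / 2, le_rfl, by norm_num, by norm_num, fun j hj => absurd hj (by omega)⟩
  | succ J ih =>
    obtain ⟨C, δ, hC, hδ, hδ1, h⟩ := ih
    obtain ⟨C', hC', h'⟩ := norm_sum_e_iterDiff_le_of_length hc J J
    set δ₁ : ℝ := 1 / (20 * (J + 1)) / 2 ^ J with hδ₁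
    have hδ₁_pos : 0 < δ₁ := by positivity
    refine ⟨max C C', min δ δ₁, le_max_of_le_left hC, lt_min hδ hδ₁_pos,
      (min_le_left _ _).trans_lt hδ1, fun j hj M β hM hlo hhi a N haM hN => ?_⟩
    have hM1 : (1 : ℝ) ≤ M := by exact_mod_cast hM
    rcases Nat.lt_succ_iff_lt_or_eq.1 hj with hj | rfl
    · refine (h j hj M β hM hlo hhi a N haM hN).trans ?_
      refine mul_le_mul (le_max_left _ _) (Real.rpow_le_rpow_of_exponent_le hM1 ?_)
        (by positivity) (le_max_of_le_left hC)
      linarith [min_le_left δ δ₁]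
    · refine (h' M β hM hlo hhi [] (by simp) (by simp) a N haM hN).trans ?_
      refine mul_le_mul (le_max_right _ _) (Real.rpow_le_rpow_of_exponent_le hM1 ?_)
        (by positivity) (le_max_of_le_left hC)
      linarith [min_le_right δ δ₁]

/-- Power saving in the exponential sums `∑ e (β n ^ c)` over subintervals of `[M, 2M)`, uniformly
in `β` of polynomial size. -/
theorem norm_sum_Ico_e_le {c : ℝ} (hc1 : 1 < c) (hc : ∀ m : ℤ, c ≠ m) {κ : ℝ} (hκ : 0 < κ)
    (A : ℝ) :
    ∃ C δ : ℝ, 0 ≤ C ∧ 0 < δ ∧ δ < 1 ∧ ∀ (M : ℕ) (β : ℝ), 1 ≤ M → κ ≤ |β| → |β| ≤ (M : ℝ) ^ A →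
      ∀ a b : ℕ, M ≤ a → b ≤ 2 * M →
      ‖∑ n ∈ Finset.Ico a b, e (β * (n : ℝ) ^ c)‖ ≤ C * (M : ℝ) ^ (1 - δ) := by
  -- As `|β| M ^ c ≤ M ^ (A + c)`, the number of differencing steps never exceeds `⌈A + c⌉`.
  obtain ⟨C, δ, hC, hδ, hδ1, h⟩ := exists_uniform_power_saving hc (⌈A + c⌉₊ + 1)
  -- Below the first size range, `κ M ^ c < M ^ (4/5)` forces `M ≤ M0`, and the trivial bound
  -- suffices.
  set M0 : ℝ := (1 / κ) ^ (1 / (c - 4 / 5)) with hM0def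
  have hM00 : 0 ≤ M0 := by positivity
  refine ⟨C + M0 + 1, δ, by linarith, hδ, hδ1, fun M β hM hκβ hβ a b haM hb => ?_⟩
  have hM1 : (1 : ℝ) ≤ M := by exact_mod_cast hM
  have hM0 : (0 : ℝ) < M := by linarith
  have hpow1 : 1 ≤ (M : ℝ) ^ (1 - δ) := Real.one_le_rpow hM1 (by linarith)
  have htriv : ‖∑ n ∈ Finset.Ico a b, e (β * (n : ℝ) ^ c)‖ ≤ M := by
    refine (norm_sum_e_le_card _ (fun n => β * (n : ℝ) ^ c)).trans ?_
    rw [Nat.card_Ico]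
    exact_mod_cast (by omega : b - a ≤ M)
  rcases Nat.lt_or_ge 1 M with hM2 | hM2
  swap
  · have : (M : ℝ) = 1 := by
      have : M = 1 := by omega
      simp [this]
    rw [this] at htriv ⊢
    rw [Real.one_rpow]
    linarith
  have hM2' : (1 : ℝ) < M := by exact_mod_cast hM2
  rcases lt_or_ge (|β| * (M : ℝ) ^ c) ((M : ℝ) ^ (4 / 5 : ℝ)) with hsmall | hlarge
  · have h1 : (M : ℝ) ^ (c - 4 / 5) ≤ 1 / κ := by
      rw [Real.rpow_sub hM0, div_le_div_iff₀ (by positivity) hκ]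
      have : κ * (M : ℝ) ^ c ≤ |β| * (M : ℝ) ^ c := by gcongr
      linarith
    have h2 : (M : ℝ) ≤ M0 := by
      calc (M : ℝ) = ((M : ℝ) ^ (c - 4 / 5)) ^ (1 / (c - 4 / 5)) := by
            rw [← Real.rpow_mul hM0.le, mul_one_div_cancel (by linarith), Real.rpow_one]
        _ ≤ _ := Real.rpow_le_rpow (by positivity) h1 (by
            apply one_div_nonneg.2; linarith)
    calc _ ≤ M0 * 1 := by linarith
      _ ≤ _ := mul_le_mul (by linarith) hpow1 zero_le_one (by linarith)
  -- The ranges `[M ^ (j + 4/5), M ^ (j + 9/5)]` cover everything from `M ^ (4/5)` on; `j` is the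
  -- exponent for which `|β| M ^ c / M ^ (4/5)` lies in `[M ^ j, M ^ (j + 1))`.
  · obtain ⟨j, hj1, hj2⟩ := exists_nat_pow_near
      (x := |β| * (M : ℝ) ^ c / (M : ℝ) ^ (4 / 5 : ℝ)) (y := M)
      ((one_le_div (by positivity)).2 hlarge) hM2'
    rw [le_div_iff₀ (by positivity), ← Real.rpow_natCast, ← Real.rpow_add hM0] at hj1
    rw [div_lt_iff₀ (by positivity), ← Real.rpow_natCast, ← Real.rpow_add hM0] at hj2
    have hjJ : j < ⌈A + c⌉₊ + 1 := by
      have h1 : (M : ℝ) ^ (j + 4 / 5 : ℝ) ≤ (M : ℝ) ^ (A + c) := by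
        refine hj1.trans ?_
        rw [Real.rpow_add hM0]
        gcongr
      have h2 := (Real.rpow_le_rpow_left_iff hM2').1 h1
      have h3 : (j : ℝ) ≤ ⌈A + c⌉₊ := by linarith [Nat.le_ceil (A + c)]
      have : j ≤ ⌈A + c⌉₊ := by exact_mod_cast h3
      omega
    have hj2' : |β| * (M : ℝ) ^ c ≤ (M : ℝ) ^ (j + 9 / 5 : ℝ) := by
      refine hj2.le.trans (le_of_eq ?_)
      congr 1
      push_cast
      ring
    rcases le_or_gt b a with hab | hab
    · rw [Finset.Ico_eq_empty_of_le hab, Finset.sum_empty, norm_zero]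
      exact mul_nonneg (by linarith) (by linarith)
    have := h j hjJ M β hM hj1 hj2' a (b - a) haM (by omega)
    rw [Finset.sum_Ico_eq_sum_range]
    refine this.trans (mul_le_mul_of_nonneg_right (by linarith) (by linarith))

/-- Power saving in `∑_{m ≤ y} e (β m ^ c)`. -/
theorem norm_sum_Ioc_e_le {c : ℝ} (hc1 : 1 < c) (hc : ∀ m : ℤ, c ≠ m) {κ : ℝ} (hκ : 0 < κ)
    {A : ℝ} (hA : 0 < A) :
    ∃ C δ : ℝ, 0 ≤ C ∧ 0 < δ ∧ δ < 1 ∧ ∀ β B : ℝ, κ ≤ |β| → |β| ≤ B → ∀ y : ℕ,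
      ‖∑ n ∈ Finset.Ioc 0 y, e (β * (n : ℝ) ^ c)‖ ≤ 2 * B ^ (1 / A) + C * (y : ℝ) ^ (1 - δ) := by
  obtain ⟨C, δ, hC, hδ, hδ1, h⟩ := norm_sum_Ico_e_le hc1 hc hκ A
  -- Halving `y` repeatedly sums the block bounds in a geometric series of ratio `q`, whence the
  -- constant `C / (1 - q)`.
  set q : ℝ := (1 / 2 : ℝ) ^ (1 - δ) with hq
  have hq1 : q < 1 := Real.rpow_lt_one (by norm_num) (by norm_num) (by linarith)
  have hq0 : 0 < q := by positivity
  have hq2 : 0 < 1 - q := by linarith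
  refine ⟨C / (1 - q), δ, by positivity, hδ, hδ1, fun β B hκβ hβB y => ?_⟩
  have hB0 : 0 < B := by linarith
  have hBA : 0 < B ^ (1 / A) := by positivity
  induction y using Nat.strong_induction_on with
  | _ y ih =>
  rcases Nat.eq_zero_or_pos y with rfl | hy
  · simp only [Finset.Ioc_self, Finset.sum_empty, norm_zero]
    positivity
  set M := y / 2 + 1 with hM
  have hMy : M ≤ y := by omega
  have hM1 : 1 ≤ M := by omega
  have hM0 : (0 : ℝ) < M := by exact_mod_cast hM1
  have hy0 : (0 : ℝ) < y := by exact_mod_cast hy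
  -- If `M ^ A < B`, the block estimate is not available for every `|β| ≤ B`, but then `y ≤ 2 M ≤ 2
  -- B ^ (1 / A)` and the trivial bound suffices.
  rcases lt_or_ge ((M : ℝ) ^ A) B with hMB | hMB
  · have h1 : (M : ℝ) ≤ B ^ (1 / A) := by
      calc (M : ℝ) = ((M : ℝ) ^ A) ^ (1 / A) := by
            rw [← Real.rpow_mul hM0.le, mul_one_div_cancel hA.ne', Real.rpow_one]
        _ ≤ _ := Real.rpow_le_rpow (by positivity) hMB.le (by positivity)
    have h2 : (y : ℝ) ≤ 2 * M := by exact_mod_cast (by omega : y ≤ 2 * M)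
    refine (norm_sum_e_le_card _ (fun n => β * (n : ℝ) ^ c)).trans ?_
    rw [Nat.card_Ioc, Nat.sub_zero]
    have : 0 ≤ C / (1 - q) * (y : ℝ) ^ (1 - δ) := by positivity
    linarith
  · have hsplit : ∑ n ∈ Finset.Ioc 0 y, e (β * (n : ℝ) ^ c) =
        ∑ n ∈ Finset.Ioc 0 (y / 2), e (β * (n : ℝ) ^ c) +
          ∑ n ∈ Finset.Ico M (y + 1), e (β * (n : ℝ) ^ c) := by
      have : Finset.Ico M (y + 1) = Finset.Ioc (y / 2) y := by
        ext n; simp only [Finset.mem_Ico, Finset.mem_Ioc]; omega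
      rw [this, Finset.sum_Ioc_consecutive _ (by omega) (by omega)]
    rw [hsplit]
    have h1 := ih (y / 2) (by omega)
    have h2 := h M β hM1 hκβ (hβB.trans hMB) M (y + 1) le_rfl (by omega)
    have h3 : (M : ℝ) ^ (1 - δ) ≤ (y : ℝ) ^ (1 - δ) :=
      Real.rpow_le_rpow hM0.le (by exact_mod_cast hMy) (by linarith)
    have h4 : ((y / 2 : ℕ) : ℝ) ^ (1 - δ) ≤ q * (y : ℝ) ^ (1 - δ) := by
      rw [hq, ← Real.mul_rpow (by norm_num) hy0.le]
      refine Real.rpow_le_rpow (by positivity) ?_ (by linarith)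
      have := Nat.cast_div_le (α := ℝ) (m := y) (n := 2)
      push_cast at this
      linarith
    refine (norm_add_le _ _).trans ((add_le_add h1 h2).trans ?_)
    have h5 : C / (1 - q) * ((y / 2 : ℕ) : ℝ) ^ (1 - δ) ≤
        C / (1 - q) * (q * (y : ℝ) ^ (1 - δ)) := by gcongr
    have h6 : C * (M : ℝ) ^ (1 - δ) ≤ C * (y : ℝ) ^ (1 - δ) := by gcongr
    have h7 : C / (1 - q) * (q * (y : ℝ) ^ (1 - δ)) + C * (y : ℝ) ^ (1 - δ) =
        C / (1 - q) * (y : ℝ) ^ (1 - δ) := by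
      field_simp
      ring
    linarith

/-! ### Vaughan's identity and summation by parts -/

open ArithmeticFunction

/-- Summation of a Dirichlet convolution against an arbitrary weight. -/
lemma sum_Ioc_mul_apply (f g : ArithmeticFunction ℝ) (F : ℕ → ℂ) (N : ℕ) :
    ∑ n ∈ Finset.Ioc 0 N, ((f * g) n : ℂ) * F n =
      ∑ d ∈ Finset.Ioc 0 N, (f d : ℂ) * ∑ m ∈ Finset.Ioc 0 (N / d), (g m : ℂ) * F (d * m) := by
  have h1 : ∀ n ∈ Finset.Ioc 0 N, ((f * g) n : ℂ) * F n =
      ∑ x ∈ Finset.Ioc 0 N ×ˢ Finset.Ioc 0 N,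
        if x.1 * x.2 = n then (f x.1 : ℂ) * ((g x.2 : ℂ) * F (x.1 * x.2)) else 0 := by
    intro n hn
    rw [Finset.mem_Ioc] at hn
    rw [ArithmeticFunction.mul_apply,
      Nat.divisorsAntidiagonal_eq_prod_filter_of_le hn.1.ne' hn.2, ← Finset.sum_filter]
    push_cast
    rw [Finset.sum_mul]
    refine Finset.sum_congr rfl fun x hx => ?_
    rw [(Finset.mem_filter.1 hx).2]
    ring
  rw [Finset.sum_congr rfl h1, Finset.sum_comm, Finset.sum_product]
  refine Finset.sum_congr rfl fun d hd => ?_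
  rw [Finset.mem_Ioc] at hd
  rw [Finset.mul_sum]
  simp only [Finset.sum_ite_eq, Finset.mem_Ioc]
  rw [← Finset.sum_filter]
  refine Finset.sum_congr ?_ fun _ _ => rfl
  ext m
  simp only [Finset.mem_filter, Finset.mem_Ioc]
  rw [Nat.le_div_iff_mul_le hd.1, mul_comm m d]
  constructor
  · rintro ⟨⟨h1, h2⟩, h3, h4⟩
    exact ⟨h1, h4⟩
  · rintro ⟨h1, h2⟩
    exact ⟨⟨h1, (Nat.le_mul_of_pos_left m hd.1).trans h2⟩, Nat.mul_pos hd.1 h1, h2⟩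

/-- The restriction of an arithmetic function to `[1, U]`. -/
def restrictLE (f : ArithmeticFunction ℝ) (U : ℕ) : ArithmeticFunction ℝ :=
  ⟨fun n => if n ≤ U then f n else 0, by simp⟩

/-- The restriction of an arithmetic function to `(U, ∞)`. -/
def restrictGT (f : ArithmeticFunction ℝ) (U : ℕ) : ArithmeticFunction ℝ :=
  ⟨fun n => if n ≤ U then 0 else f n, by simp⟩

lemma restrictLE_apply (f : ArithmeticFunction ℝ) (U n : ℕ) :
    restrictLE f U n = if n ≤ U then f n else 0 := rfl

lemma restrictGT_apply (f : ArithmeticFunction ℝ) (U n : ℕ) :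
    restrictGT f U n = if n ≤ U then 0 else f n := rfl

lemma restrictLE_add_restrictGT (f : ArithmeticFunction ℝ) (U : ℕ) :
    restrictLE f U + restrictGT f U = f := by
  ext n
  rw [ArithmeticFunction.add_apply, restrictLE_apply, restrictGT_apply]
  split_ifs <;> simp

/-- The Vaughan identity. -/
lemma vaughan_identity (U : ℕ) :
    (vonMangoldt : ArithmeticFunction ℝ) +
      restrictLE (moebius : ArithmeticFunction ℝ) U * restrictLE vonMangoldt U *
        (zeta : ArithmeticFunction ℝ) =
      restrictLE vonMangoldt U +
      restrictLE (moebius : ArithmeticFunction ℝ) U * ArithmeticFunction.log +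
      restrictGT (moebius : ArithmeticFunction ℝ) U *
        (restrictGT vonMangoldt U * (zeta : ArithmeticFunction ℝ)) := by
  have h1 := restrictLE_add_restrictGT vonMangoldt U
  have h2 := restrictLE_add_restrictGT (moebius : ArithmeticFunction ℝ) U
  have h3 : (moebius : ArithmeticFunction ℝ) * (zeta : ArithmeticFunction ℝ) = 1 :=
    coe_moebius_mul_coe_zeta
  have h4 : vonMangoldt * (zeta : ArithmeticFunction ℝ) = ArithmeticFunction.log :=
    vonMangoldt_mul_zeta
  rw [← h4]
  set a := restrictLE vonMangoldt U
  set b := restrictGT vonMangoldt U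
  set x := restrictLE (moebius : ArithmeticFunction ℝ) U
  set y := restrictGT (moebius : ArithmeticFunction ℝ) U
  rw [← h1]
  rw [← h2] at h3
  -- After writing the von Mangoldt function as `a + b`, everything cancels except `b = b (x + y)
  -- ζ`, which is Möbius inversion.
  linear_combination (-b) * h3

lemma abs_restrictLE_moebius_le (U n : ℕ) :
    |restrictLE (moebius : ArithmeticFunction ℝ) U n| ≤ 1 := by
  rw [restrictLE_apply]
  split_ifs
  · rw [intCoe_apply]; exact_mod_cast abs_moebius_le_one
  · simp

lemma abs_restrictGT_moebius_le (U n : ℕ) :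
    |restrictGT (moebius : ArithmeticFunction ℝ) U n| ≤ 1 := by
  rw [restrictGT_apply]
  split_ifs
  · simp
  · rw [intCoe_apply]; exact_mod_cast abs_moebius_le_one

/-- The divisor sum of the von Mangoldt function is `log n`. This controls the convolved
coefficients in Vaughan's identity, about which nothing else is needed. -/
lemma abs_mul_le_log {f g : ArithmeticFunction ℝ} (hf : ∀ n, |f n| ≤ 1)
    (hg : ∀ n, |g n| ≤ vonMangoldt n) (n : ℕ) : |(f * g) n| ≤ Real.log n := by
  rw [ArithmeticFunction.mul_apply]
  refine (Finset.abs_sum_le_sum_abs _ _).trans ?_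
  rw [← vonMangoldt_sum]
  calc ∑ x ∈ n.divisorsAntidiagonal, |f x.1 * g x.2|
      ≤ ∑ x ∈ n.divisorsAntidiagonal, vonMangoldt x.2 := by
        refine Finset.sum_le_sum fun x _ => ?_
        rw [abs_mul]
        calc |f x.1| * |g x.2| ≤ 1 * vonMangoldt x.2 :=
              mul_le_mul (hf _) (hg _) (abs_nonneg _) zero_le_one
          _ = _ := one_mul _
    _ = _ := Nat.sum_divisorsAntidiagonal' (fun _ y => vonMangoldt y)

lemma abs_restrictLE_vonMangoldt_le (U n : ℕ) :
    |restrictLE vonMangoldt U n| ≤ vonMangoldt n := by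
  rw [restrictLE_apply]
  split_ifs
  · rw [abs_of_nonneg vonMangoldt_nonneg]
  · simp

lemma abs_restrictGT_vonMangoldt_le (U n : ℕ) :
    |restrictGT vonMangoldt U n| ≤ vonMangoldt n := by
  rw [restrictGT_apply]
  split_ifs
  · simp
  · rw [abs_of_nonneg vonMangoldt_nonneg]

lemma abs_zeta_le (n : ℕ) : |(zeta : ArithmeticFunction ℝ) n| ≤ 1 := by
  rw [natCoe_apply, zeta_apply]
  split_ifs <;> simp

lemma restrictLE_mul_restrictLE_eq_zero (f g : ArithmeticFunction ℝ) {U n : ℕ}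
    (hn : U * U < n) : (restrictLE f U * restrictLE g U) n = 0 := by
  rw [ArithmeticFunction.mul_apply]
  refine Finset.sum_eq_zero fun x hx => ?_
  rw [Nat.mem_divisorsAntidiagonal] at hx
  rw [restrictLE_apply, restrictLE_apply]
  split_ifs with h1 h2
  · have := Nat.mul_le_mul h1 h2
    omega
  all_goals simp

lemma restrictGT_mul_eq_zero (f g : ArithmeticFunction ℝ) {U n : ℕ} (hn : n ≤ U) :
    (restrictGT f U * g) n = 0 := by
  rw [ArithmeticFunction.mul_apply]
  refine Finset.sum_eq_zero fun x hx => ?_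
  rw [Nat.mem_divisorsAntidiagonal] at hx
  have : x.1 ≤ n := Nat.le_of_dvd (Nat.pos_of_ne_zero hx.2) ⟨x.2, hx.1.symm⟩
  rw [restrictGT_apply, if_pos (by omega), zero_mul]

/-- Summation by parts. -/
lemma norm_sum_mul_sub_le (w : ℕ → ℝ) (z : ℕ → ℂ) (y : ℕ) {B : ℝ}
    (hB : ∀ j ≤ y, ‖∑ n ∈ Finset.Ioc 0 j, z n‖ ≤ B) :
    ‖∑ n ∈ Finset.Ioc 0 y, (w n : ℂ) * z n - w y * ∑ n ∈ Finset.Ioc 0 y, z n‖ ≤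
      (∑ j ∈ Finset.range y, |w (j + 1) - w j|) * B := by
  induction y with
  | zero => simp
  | succ y ih =>
    have h1 := ih fun j hj => hB j (by omega)
    have h2 := hB y (by omega)
    rw [Finset.sum_Ioc_succ_top (by omega), Finset.sum_Ioc_succ_top (by omega),
      Finset.sum_range_succ, add_mul]
    set S := ∑ n ∈ Finset.Ioc 0 y, (w n : ℂ) * z n
    set Z := ∑ n ∈ Finset.Ioc 0 y, z n
    have : S + (w (y + 1) : ℂ) * z (y + 1) - w (y + 1) * (Z + z (y + 1)) =
        (S - w y * Z) - ((w (y + 1) - w y : ℝ) : ℂ) * Z := by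
      push_cast; ring
    rw [this]
    refine (norm_sub_le _ _).trans (add_le_add h1 ?_)
    rw [norm_mul, Complex.norm_real, Real.norm_eq_abs]
    gcongr

/-- For monotone weights the total variation telescopes to `w y - w 0`, so a slowly growing weight
such as the logarithm costs only a factor of its size. -/
lemma norm_sum_mul_le_of_monotone {w : ℕ → ℝ} (hw : Monotone w) (hw0 : 0 ≤ w 0) (z : ℕ → ℂ)
    (y : ℕ) {B : ℝ} (hB : ∀ j ≤ y, ‖∑ n ∈ Finset.Ioc 0 j, z n‖ ≤ B) :
    ‖∑ n ∈ Finset.Ioc 0 y, (w n : ℂ) * z n‖ ≤ 2 * w y * B := by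
  have hB0 : 0 ≤ B := (norm_nonneg _).trans (hB 0 (by omega))
  have h1 := norm_sum_mul_sub_le w z y hB
  have h2 : ∑ j ∈ Finset.range y, |w (j + 1) - w j| = w y - w 0 := by
    rw [← Finset.sum_range_sub]
    exact Finset.sum_congr rfl fun j _ => abs_of_nonneg (sub_nonneg.2 (hw (by omega)))
  rw [h2] at h1
  have hwy : 0 ≤ w y := hw0.trans (hw (by omega))
  have h3 : ‖(w y : ℂ) * ∑ n ∈ Finset.Ioc 0 y, z n‖ ≤ w y * B := by
    rw [norm_mul, Complex.norm_real, Real.norm_of_nonneg hwy]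
    exact mul_le_mul_of_nonneg_left (hB y le_rfl) hwy
  have h4 := norm_sub_norm_le (∑ n ∈ Finset.Ioc 0 y, (w n : ℂ) * z n)
    ((w y : ℂ) * ∑ n ∈ Finset.Ioc 0 y, z n)
  nlinarith [mul_nonneg hw0 hB0]

lemma norm_sum_mul_le_of_antitone {w : ℕ → ℝ} (hw : Antitone w) (hw0 : ∀ n, 0 ≤ w n) (z : ℕ → ℂ)
    (y : ℕ) {B : ℝ} (hB : ∀ j ≤ y, ‖∑ n ∈ Finset.Ioc 0 j, z n‖ ≤ B) :
    ‖∑ n ∈ Finset.Ioc 0 y, (w n : ℂ) * z n‖ ≤ w 0 * B := by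
  have h1 := norm_sum_mul_sub_le w z y hB
  have h2 : ∑ j ∈ Finset.range y, |w (j + 1) - w j| = w 0 - w y := by
    rw [← Finset.sum_range_sub']
    refine Finset.sum_congr rfl fun j _ => ?_
    rw [abs_of_nonpos (sub_nonpos.2 (hw (by omega))), neg_sub]
  rw [h2] at h1
  have h3 : ‖(w y : ℂ) * ∑ n ∈ Finset.Ioc 0 y, z n‖ ≤ w y * B := by
    rw [norm_mul, Complex.norm_real, Real.norm_of_nonneg (hw0 y)]
    exact mul_le_mul_of_nonneg_left (hB y le_rfl) (hw0 y)
  have h4 := norm_sub_norm_le (∑ n ∈ Finset.Ioc 0 y, (w n : ℂ) * z n)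
    ((w y : ℂ) * ∑ n ∈ Finset.Ioc 0 y, z n)
  linarith

/-! ### Bilinear sums -/

/-- Cauchy–Schwarz for one dyadic block of a bilinear sum. -/
lemma norm_sq_bilinear_block_le (α c : ℝ) (f g : ℕ → ℝ) (N M : ℕ) (hM : 1 ≤ M) {L E : ℝ}
    (hE0 : 0 ≤ E) (hf : ∀ d, |f d| ≤ 1) (hg : ∀ m ≤ N, |g m| ≤ L)
    (hE : ∀ m₁ ∈ Finset.Ioc 0 (N / M), ∀ m₂ ∈ Finset.Ioc 0 (N / M), m₁ ≠ m₂ → ∀ b ≤ 2 * M,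
      ‖∑ d ∈ Finset.Ico M b, e (α * ((m₁ : ℝ) ^ c - (m₂ : ℝ) ^ c) * (d : ℝ) ^ c)‖ ≤ E) :
    ‖∑ d ∈ Finset.Ico M (2 * M), (f d : ℂ) * ∑ m ∈ Finset.Ioc 0 (N / d),
      (g m : ℂ) * e (α * ((d * m : ℕ) : ℝ) ^ c)‖ ^ 2 ≤
      L ^ 2 * (N * M + N ^ 2 * (E / M)) := by
  have hM0 : (0 : ℝ) < M := by exact_mod_cast hM
  set n := N / M with hn
  -- The condition `d m ≤ N` is moved into the summand so that the range `m ≤ N / M` no longer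
  -- depends on `d`, and the order of summation can be exchanged after squaring.
  set h : ℕ → ℕ → ℂ := fun m d => if d * m ≤ N then (g m : ℂ) * e (α * ((d * m : ℕ) : ℝ) ^ c) else 0
    with hh
  have hG : ∀ d ∈ Finset.Ico M (2 * M), ∑ m ∈ Finset.Ioc 0 (N / d),
      (g m : ℂ) * e (α * ((d * m : ℕ) : ℝ) ^ c) = ∑ m ∈ Finset.Ioc 0 n, h m d := by
    intro d hd
    rw [Finset.mem_Ico] at hd
    simp only [hh]
    rw [← Finset.sum_filter]
    refine Finset.sum_congr ?_ fun _ _ => rfl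
    ext m
    simp only [Finset.mem_Ioc, Finset.mem_filter]
    rw [Nat.le_div_iff_mul_le (by omega), mul_comm m d, hn, Nat.le_div_iff_mul_le (by omega)]
    constructor
    · rintro ⟨h1, h2⟩
      refine ⟨⟨h1, le_trans ?_ h2⟩, h2⟩
      rw [mul_comm]
      exact Nat.mul_le_mul_right _ hd.1
    · rintro ⟨⟨h1, _⟩, h2⟩; exact ⟨h1, h2⟩
  have hL : 0 ≤ L := (abs_nonneg _).trans (hg 0 (by omega))
  have hnN : n ≤ N := Nat.div_le_self _ _
  have hcorr : ∀ m₁ ∈ Finset.Ioc 0 n, ∀ m₂ ∈ Finset.Ioc 0 n,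
      ‖∑ d ∈ Finset.Ico M (2 * M), h m₁ d * starRingEnd ℂ (h m₂ d)‖ ≤
        L ^ 2 * ((if m₁ = m₂ then (M : ℝ) else 0) + E) := by
    intro m₁ h₁ m₂ h₂
    have p₁ := Finset.mem_Ioc.1 h₁
    have p₂ := Finset.mem_Ioc.1 h₂
    have hterm : ∀ d, h m₁ d * starRingEnd ℂ (h m₂ d) =
        if d * m₁ ≤ N ∧ d * m₂ ≤ N then ((g m₁ * g m₂ : ℝ) : ℂ) *
          e (α * ((m₁ : ℝ) ^ c - (m₂ : ℝ) ^ c) * (d : ℝ) ^ c) else 0 := by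
      intro d
      simp only [hh]
      split_ifs with a1 a2 a3 a4 a5 a6 <;> first | rfl | (exfalso; tauto) | skip
      · have : α * ((m₁ : ℝ) ^ c - (m₂ : ℝ) ^ c) * (d : ℝ) ^ c =
            α * ((d * m₁ : ℕ) : ℝ) ^ c - α * ((d * m₂ : ℕ) : ℝ) ^ c := by
          push_cast
          rw [Real.mul_rpow (by positivity) (by positivity),
            Real.mul_rpow (by positivity) (by positivity)]
          ring
        rw [this, e_sub, map_mul, Complex.conj_ofReal]
        push_cast
        ring
      all_goals simp
    -- For fixed `m₁` and `m₂` the two hyperbolic conditions only truncate the block from above.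
    -- This is why the hypothesis `hE` is required for all endpoints `b ≤ 2 M`.
    have hset : (Finset.Ico M (2 * M)).filter (fun d => d * m₁ ≤ N ∧ d * m₂ ≤ N) =
        Finset.Ico M (min (2 * M) (min (N / m₁ + 1) (N / m₂ + 1))) := by
      ext d
      simp only [Finset.mem_filter, Finset.mem_Ico, lt_min_iff, Nat.lt_succ_iff]
      rw [Nat.le_div_iff_mul_le p₁.1, Nat.le_div_iff_mul_le p₂.1]
      tauto
    simp only [hterm]
    rw [← Finset.sum_filter, hset, ← Finset.mul_sum, norm_mul, Complex.norm_real,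
      Real.norm_eq_abs, abs_mul, sq]
    refine mul_le_mul ?_ ?_ (norm_nonneg _) (by positivity)
    · exact mul_le_mul (hg _ (by omega)) (hg _ (by omega)) (abs_nonneg _) hL
    · split_ifs with heq
      · refine (norm_sum_e_le_card _
          (fun d : ℕ => α * ((m₁ : ℝ) ^ c - (m₂ : ℝ) ^ c) * (d : ℝ) ^ c)).trans ?_
        rw [Nat.card_Ico]
        have : ((min (2 * M) (min (N / m₁ + 1) (N / m₂ + 1)) - M : ℕ) : ℝ) ≤ M := by
          exact_mod_cast (by omega)
        linarith
      · rw [zero_add]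
        exact hE m₁ h₁ m₂ h₂ heq _ (min_le_left _ _)
  have hcs : ‖∑ d ∈ Finset.Ico M (2 * M), (f d : ℂ) * ∑ m ∈ Finset.Ioc 0 (N / d),
      (g m : ℂ) * e (α * ((d * m : ℕ) : ℝ) ^ c)‖ ^ 2 ≤
      M * ∑ d ∈ Finset.Ico M (2 * M), ‖∑ m ∈ Finset.Ioc 0 n, h m d‖ ^ 2 := by
    have h1 : ‖∑ d ∈ Finset.Ico M (2 * M), (f d : ℂ) * ∑ m ∈ Finset.Ioc 0 (N / d),
        (g m : ℂ) * e (α * ((d * m : ℕ) : ℝ) ^ c)‖ ≤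
        ∑ d ∈ Finset.Ico M (2 * M), ‖∑ m ∈ Finset.Ioc 0 n, h m d‖ := by
      refine (norm_sum_le _ _).trans (Finset.sum_le_sum fun d hd => ?_)
      rw [hG d hd, norm_mul, Complex.norm_real, Real.norm_eq_abs]
      exact mul_le_of_le_one_left (norm_nonneg _) (hf d)
    refine (pow_le_pow_left₀ (norm_nonneg _) h1 2).trans ?_
    have := sq_sum_le_card_mul_sum_sq (s := Finset.Ico M (2 * M))
      (f := fun d => ‖∑ m ∈ Finset.Ioc 0 n, h m d‖)
    rw [Nat.card_Ico, (by omega : 2 * M - M = M)] at this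
    exact this
  have hexp : ∑ d ∈ Finset.Ico M (2 * M), ‖∑ m ∈ Finset.Ioc 0 n, h m d‖ ^ 2 ≤
      L ^ 2 * (n * M + (n : ℝ) ^ 2 * E) := by
    have h1 : ((∑ d ∈ Finset.Ico M (2 * M), ‖∑ m ∈ Finset.Ioc 0 n, h m d‖ ^ 2 : ℝ) : ℂ) =
        ∑ m₁ ∈ Finset.Ioc 0 n, ∑ m₂ ∈ Finset.Ioc 0 n,
          ∑ d ∈ Finset.Ico M (2 * M), h m₁ d * starRingEnd ℂ (h m₂ d) := by
      push_cast
      have : ∀ d, ((‖∑ m ∈ Finset.Ioc 0 n, h m d‖ : ℂ)) ^ 2 =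
          ∑ m₁ ∈ Finset.Ioc 0 n, ∑ m₂ ∈ Finset.Ioc 0 n, h m₁ d * starRingEnd ℂ (h m₂ d) := by
        intro d
        rw [← Complex.mul_conj', map_sum, Finset.sum_mul_sum]
      simp only [this]
      rw [Finset.sum_comm]
      refine Finset.sum_congr rfl fun m _ => ?_
      rw [Finset.sum_comm]
    have h2 : ∑ d ∈ Finset.Ico M (2 * M), ‖∑ m ∈ Finset.Ioc 0 n, h m d‖ ^ 2 =
        ‖((∑ d ∈ Finset.Ico M (2 * M), ‖∑ m ∈ Finset.Ioc 0 n, h m d‖ ^ 2 : ℝ) : ℂ)‖ := by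
      rw [Complex.norm_real, Real.norm_of_nonneg (by positivity)]
    rw [h2, h1]
    calc _ ≤ ∑ m₁ ∈ Finset.Ioc 0 n, ∑ m₂ ∈ Finset.Ioc 0 n,
          L ^ 2 * ((if m₁ = m₂ then (M : ℝ) else 0) + E) := by
          refine (norm_sum_le _ _).trans (Finset.sum_le_sum fun m hm => ?_)
          refine (norm_sum_le _ _).trans (Finset.sum_le_sum fun m' hm' => ?_)
          exact hcorr m hm m' hm'
      _ = _ := by
          have : ∀ m ∈ Finset.Ioc 0 n, ∑ m' ∈ Finset.Ioc 0 n,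
              L ^ 2 * ((if m = m' then (M : ℝ) else 0) + E) = L ^ 2 * (M + n * E) := by
            intro m hm
            rw [← Finset.mul_sum, Finset.sum_add_distrib, Finset.sum_ite_eq, if_pos hm]
            simp
          rw [Finset.sum_congr rfl this]
          simp
          ring
  have hnM : (n : ℝ) ≤ N / M := Nat.cast_div_le
  refine hcs.trans ((mul_le_mul_of_nonneg_left hexp hM0.le).trans ?_)
  calc (M : ℝ) * (L ^ 2 * (n * M + (n : ℝ) ^ 2 * E))
      ≤ M * (L ^ 2 * (N / M * M + (N / M : ℝ) ^ 2 * E)) := by gcongr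
    _ = _ := by field_simp

/-- A function on the natural numbers is `O(N ^ (1 - δ))` for some `δ > 0`. -/
def PowerSaving (f : ℕ → ℝ) : Prop :=
  ∃ δ : ℝ, 0 < δ ∧ f =O[atTop] fun N : ℕ => (N : ℝ) ^ (1 - δ)

lemma isBigO_natCast_rpow_of_le {s t : ℝ} (h : s ≤ t) :
    (fun N : ℕ => (N : ℝ) ^ s) =O[atTop] fun N : ℕ => (N : ℝ) ^ t := by
  refine Asymptotics.IsBigO.of_bound 1 ?_
  filter_upwards [eventually_ge_atTop 1] with N hN
  have hN1 : (1 : ℝ) ≤ N := by exact_mod_cast hN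
  rw [one_mul, Real.norm_of_nonneg (by positivity), Real.norm_of_nonneg (by positivity)]
  exact Real.rpow_le_rpow_of_exponent_le hN1 h

lemma powerSaving_rpow {s : ℝ} (hs : s < 1) : PowerSaving fun N => (N : ℝ) ^ s :=
  ⟨1 - s, by linarith, isBigO_natCast_rpow_of_le (by linarith)⟩

lemma PowerSaving.add {f g : ℕ → ℝ} (hf : PowerSaving f) (hg : PowerSaving g) :
    PowerSaving fun N => f N + g N := by
  obtain ⟨δ, hδ, hf⟩ := hf
  obtain ⟨ε, hε, hg⟩ := hg
  refine ⟨min δ ε, lt_min hδ hε, ?_⟩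
  exact (hf.trans (isBigO_natCast_rpow_of_le (by linarith [min_le_left δ ε]))).add
    (hg.trans (isBigO_natCast_rpow_of_le (by linarith [min_le_right δ ε])))

lemma PowerSaving.const_mul {f : ℕ → ℝ} (hf : PowerSaving f) (k : ℝ) :
    PowerSaving fun N => k * f N := by
  obtain ⟨δ, hδ, hf⟩ := hf
  exact ⟨δ, hδ, hf.const_mul_left k⟩

lemma PowerSaving.log_mul {f : ℕ → ℝ} (hf : PowerSaving f) :
    PowerSaving fun N => Real.log N * f N := by
  obtain ⟨δ, hδ, hf⟩ := hf
  refine ⟨δ / 2, by linarith, ?_⟩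
  have h1 : (fun N : ℕ => Real.log N) =O[atTop] fun N : ℕ => (N : ℝ) ^ (δ / 2) :=
    ((isLittleO_log_rpow_atTop (by linarith : 0 < δ / 2)).comp_tendsto
      tendsto_natCast_atTop_atTop).isBigO
  refine (h1.mul hf).trans_eventuallyEq ?_
  filter_upwards [eventually_gt_atTop 0] with N hN
  have hN0 : (0 : ℝ) < N := by exact_mod_cast hN
  rw [← Real.rpow_add hN0]
  congr 1
  ring

lemma PowerSaving.of_le {f g : ℕ → ℝ} (hg : PowerSaving g)
    (h : ∀ᶠ N in atTop, |f N| ≤ g N) : PowerSaving f := by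
  obtain ⟨δ, hδ, hg⟩ := hg
  refine ⟨δ, hδ, (Asymptotics.IsBigO.of_bound 1 ?_).trans hg⟩
  filter_upwards [h] with N hN
  rw [one_mul, Real.norm_eq_abs]
  exact hN.trans (le_abs_self _)

lemma sum_Ioc_inv_le (D : ℕ) : ∑ d ∈ Finset.Ioc 0 D, (d : ℝ)⁻¹ ≤ 1 + Real.log D := by
  have h := harmonic_le_one_add_log D
  rw [harmonic_eq_sum_Icc] at h
  push_cast at h
  exact h

/-- For `d ≤ N ^ (2/3)` the inner length `N / d` is at least `N ^ (1/3)`, so each inner sum saves a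
factor `N ^ (δ/3)`; the remaining sum of `1 / d` costs a logarithm. -/
lemma sum_typeI_le {B C δ : ℝ} (hB : 0 ≤ B) (hC : 0 ≤ C) (hδ : 0 < δ) (hδ1 : δ < 1) {N D : ℕ}
    (hN : 1 ≤ N) (hD : (D : ℝ) ≤ (N : ℝ) ^ (2 / 3 : ℝ)) :
    ∑ d ∈ Finset.Ioc 0 D, (B + C * ((N / d : ℕ) : ℝ) ^ (1 - δ)) ≤
      B * (N : ℝ) ^ (2 / 3 : ℝ) + C * ((N : ℝ) ^ (1 - δ / 3) * (1 + Real.log N)) := by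
  have hN1 : (1 : ℝ) ≤ N := by exact_mod_cast hN
  have hN0 : (0 : ℝ) < N := by linarith
  rw [Finset.sum_add_distrib, ← Finset.mul_sum]
  refine add_le_add ?_ (mul_le_mul_of_nonneg_left ?_ hC)
  · simp only [Finset.sum_const, Nat.card_Ioc, Nat.sub_zero, nsmul_eq_mul]
    rw [mul_comm]
    gcongr
  · have hterm : ∀ d ∈ Finset.Ioc 0 D, ((N / d : ℕ) : ℝ) ^ (1 - δ) ≤
        (N : ℝ) ^ (1 - δ / 3) * (d : ℝ)⁻¹ := by
      intro d hd
      rw [Finset.mem_Ioc] at hd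
      have hd0 : (0 : ℝ) < d := by exact_mod_cast hd.1
      have hdD : (d : ℝ) ≤ (N : ℝ) ^ (2 / 3 : ℝ) := le_trans (by exact_mod_cast hd.2) hD
      have h1 : (N : ℝ) ^ (1 / 3 : ℝ) ≤ N / d := by
        rw [le_div_iff₀ hd0]
        calc (N : ℝ) ^ (1 / 3 : ℝ) * d ≤ (N : ℝ) ^ (1 / 3 : ℝ) * (N : ℝ) ^ (2 / 3 : ℝ) := by gcongr
          _ = N := by rw [← Real.rpow_add hN0]; norm_num
      calc ((N / d : ℕ) : ℝ) ^ (1 - δ) ≤ (N / d : ℝ) ^ (1 - δ) :=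
            Real.rpow_le_rpow (by positivity) Nat.cast_div_le (by linarith)
        _ = (N / d : ℝ) * (N / d : ℝ) ^ (-δ) := by
            rw [sub_eq_add_neg, Real.rpow_add (by positivity), Real.rpow_one]
        _ ≤ (N / d : ℝ) * ((N : ℝ) ^ (1 / 3 : ℝ)) ^ (-δ) := by
            refine mul_le_mul_of_nonneg_left ?_ (by positivity)
            exact Real.rpow_le_rpow_of_nonpos (by positivity) h1 (by linarith)
        _ = (N : ℝ) * (N : ℝ) ^ (-(δ / 3)) * (d : ℝ)⁻¹ := by
            rw [← Real.rpow_mul hN0.le, div_eq_mul_inv]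
            have : (1 / 3 : ℝ) * -δ = -(δ / 3) := by ring
            rw [this]; ring
        _ = _ := by
            rw [sub_eq_add_neg, Real.rpow_add hN0, Real.rpow_one]
    refine (Finset.sum_le_sum hterm).trans ?_
    rw [← Finset.mul_sum]
    refine mul_le_mul_of_nonneg_left ((sum_Ioc_inv_le D).trans ?_) (by positivity)
    rcases Nat.eq_zero_or_pos D with rfl | hD0
    · simp [Real.log_nonneg hN1]
    have : (D : ℝ) ≤ N := hD.trans (by
      calc (N : ℝ) ^ (2 / 3 : ℝ) ≤ (N : ℝ) ^ (1 : ℝ) :=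
            Real.rpow_le_rpow_of_exponent_le hN1 (by norm_num)
        _ = N := Real.rpow_one _)
    have hDpos : (0 : ℝ) < D := by exact_mod_cast hD0
    linarith [Real.log_le_log hDpos this]

/-- Bilinear sums with one smooth variable: power saving, uniformly over the coefficients. -/
lemma exists_powerSaving_typeI {c : ℝ} (hc1 : 1 < c) (hc : ∀ m : ℤ, c ≠ m) {α : ℝ} (hα : α ≠ 0) :
    ∃ b : ℕ → ℝ, PowerSaving b ∧ ∀ (N D : ℕ) (L : ℝ) (f : ℕ → ℝ) (w : ℕ → ℝ), 1 ≤ N →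
      (D : ℝ) ≤ (N : ℝ) ^ (2 / 3 : ℝ) → D ≤ N → (∀ d ≤ N, |f d| ≤ L) → (∀ d, D < d → f d = 0) →
      Monotone w → 0 ≤ w 0 →
      ‖∑ d ∈ Finset.Ioc 0 N, (f d : ℂ) * ∑ m ∈ Finset.Ioc 0 (N / d),
        (w m : ℂ) * e (α * ((d * m : ℕ) : ℝ) ^ c)‖ ≤ L * w N * b N := by
  have hα0 : 0 < |α| := abs_pos.2 hα
  -- The inner frequency `α d ^ c` has absolute value between `|α|` and `|α| N ^ c`. With `A = 6 c`
  -- the trivial part of the bound is of order `N ^ (1/6)`, hence `N ^ (5/6)` after summing over `d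
  -- ≤ N ^ (2/3)`.
  obtain ⟨C, δ, hC, hδ, hδ1, h⟩ := norm_sum_Ioc_e_le hc1 hc hα0 (A := 6 * c) (by linarith)
  refine ⟨fun N => 2 * (2 * |α| ^ (1 / (6 * c)) * (N : ℝ) ^ (5 / 6 : ℝ) +
    C * ((N : ℝ) ^ (1 - δ / 3) + Real.log N * (N : ℝ) ^ (1 - δ / 3))), ?_, ?_⟩
  · have h1 : PowerSaving fun N => (N : ℝ) ^ (1 - δ / 3) := powerSaving_rpow (by linarith)
    exact (((powerSaving_rpow (by norm_num : (5 / 6 : ℝ) < 1)).const_mul _).add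
      ((h1.add h1.log_mul).const_mul C)).const_mul 2
  intro N D L f w hN hD hDN hf hf0 hw hw0
  have hN1 : (1 : ℝ) ≤ N := by exact_mod_cast hN
  have hN0 : (0 : ℝ) < N := by linarith
  have hL : 0 ≤ L := (abs_nonneg _).trans (hf 0 (by omega))
  have hwN : 0 ≤ w N := hw0.trans (hw (by omega))
  set B := 2 * (|α| * (N : ℝ) ^ c) ^ (1 / (6 * c)) with hB
  have hinner : ∀ d ∈ Finset.Ioc 0 N, ‖∑ m ∈ Finset.Ioc 0 (N / d),
      (w m : ℂ) * e (α * ((d * m : ℕ) : ℝ) ^ c)‖ ≤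
      2 * w N * (B + C * ((N / d : ℕ) : ℝ) ^ (1 - δ)) := by
    intro d hd
    rw [Finset.mem_Ioc] at hd
    have hd1 : (1 : ℝ) ≤ d := by exact_mod_cast hd.1
    have hdN : (d : ℝ) ≤ N := by exact_mod_cast hd.2
    have habs : |α * (d : ℝ) ^ c| = |α| * (d : ℝ) ^ c := by
      rw [abs_mul, abs_of_nonneg (by positivity : (0 : ℝ) ≤ (d : ℝ) ^ c)]
    have hpart : ∀ j ≤ N / d, ‖∑ m ∈ Finset.Ioc 0 j, e (α * ((d * m : ℕ) : ℝ) ^ c)‖ ≤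
        B + C * ((N / d : ℕ) : ℝ) ^ (1 - δ) := by
      intro j hj
      have h1 := h (α * (d : ℝ) ^ c) (|α| * (N : ℝ) ^ c)
        (by rw [habs]; exact le_mul_of_one_le_right hα0.le (Real.one_le_rpow hd1 (by linarith)))
        (by rw [habs]; gcongr) j
      have h2 : ∑ m ∈ Finset.Ioc 0 j, e (α * ((d * m : ℕ) : ℝ) ^ c) =
          ∑ m ∈ Finset.Ioc 0 j, e (α * (d : ℝ) ^ c * (m : ℝ) ^ c) := by
        refine Finset.sum_congr rfl fun m _ => ?_
        rw [Nat.cast_mul, Real.mul_rpow (by positivity) (by positivity), mul_assoc]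
      rw [h2]
      refine h1.trans (add_le_add le_rfl ?_)
      gcongr
    refine (norm_sum_mul_le_of_monotone hw hw0 _ _ hpart).trans ?_
    have : w (N / d) ≤ w N := hw (Nat.div_le_self _ _)
    gcongr
  have hsub : Finset.Ioc 0 D ⊆ Finset.Ioc 0 N := Finset.Ioc_subset_Ioc_right hDN
  rw [← Finset.sum_subset hsub (by
    intro d hd hd'
    rw [Finset.mem_Ioc] at hd hd'
    rw [hf0 d (by omega)]
    simp)]
  have hBN : B * (N : ℝ) ^ (2 / 3 : ℝ) = 2 * |α| ^ (1 / (6 * c)) * (N : ℝ) ^ (5 / 6 : ℝ) := by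
    rw [hB, Real.mul_rpow hα0.le (by positivity), ← Real.rpow_mul hN0.le]
    have : c * (1 / (6 * c)) = 1 / 6 := by field_simp
    rw [this, mul_assoc, mul_assoc, ← Real.rpow_add hN0, mul_assoc]
    norm_num
  calc _ ≤ ∑ d ∈ Finset.Ioc 0 D, L * (2 * w N * (B + C * ((N / d : ℕ) : ℝ) ^ (1 - δ))) := by
        refine (norm_sum_le _ _).trans (Finset.sum_le_sum fun d hd => ?_)
        rw [norm_mul, Complex.norm_real, Real.norm_eq_abs]
        have := Finset.mem_Ioc.1 hd
        exact mul_le_mul (hf d (by omega)) (hinner d (hsub hd)) (norm_nonneg _) hL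
    _ = L * (2 * w N) * ∑ d ∈ Finset.Ioc 0 D, (B + C * ((N / d : ℕ) : ℝ) ^ (1 - δ)) := by
        rw [Finset.mul_sum]
        exact Finset.sum_congr rfl fun _ _ => by ring
    _ ≤ L * (2 * w N) * (B * (N : ℝ) ^ (2 / 3 : ℝ) +
          C * ((N : ℝ) ^ (1 - δ / 3) * (1 + Real.log N))) := by
        refine mul_le_mul_of_nonneg_left (sum_typeI_le (by positivity) hC hδ hδ1 hN hD) ?_
        positivity
    _ = _ := by rw [hBN]; ring

lemma sum_Ico_two_pow {E : Type*} [AddCommMonoid E] (F : ℕ → E) (K : ℕ) :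
    ∑ d ∈ Finset.Ico 1 (2 ^ K), F d =
      ∑ i ∈ Finset.range K, ∑ d ∈ Finset.Ico (2 ^ i) (2 * 2 ^ i), F d := by
  induction K with
  | zero => simp
  | succ K ih =>
    rw [Finset.sum_range_succ, ← ih, ← pow_succ',
      Finset.sum_Ico_consecutive _ Nat.one_le_two_pow (Nat.pow_le_pow_right (by norm_num) (by omega))]

/-- Superadditivity of `t ^ c` for `c ≥ 1` separates the values at distinct integers by at least 1.
It keeps the off-diagonal frequencies `α (m₁ ^ c - m₂ ^ c)` bounded away from zero. -/
lemma one_le_abs_rpow_sub_rpow {c : ℝ} (hc : 1 < c) {m n : ℕ} (h : m ≠ n) :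
    1 ≤ |(m : ℝ) ^ c - (n : ℝ) ^ c| := by
  wlog hlt : n < m generalizing m n
  · rw [abs_sub_comm]
    exact this h.symm (by omega)
  have h1 : (n : ℝ) ^ c + 1 ^ c ≤ (n + 1 : ℝ) ^ c :=
    Real.add_rpow_le_rpow_add (by positivity) zero_le_one hc.le
  have h2 : (n + 1 : ℝ) ^ c ≤ (m : ℝ) ^ c :=
    Real.rpow_le_rpow (by positivity) (by exact_mod_cast hlt) (by linarith)
  rw [Real.one_rpow] at h1
  exact le_trans (by linarith) (le_abs_self _)

lemma abs_rpow_sub_rpow_le {c : ℝ} (hc : 1 < c) {m n N : ℕ} (hm : m ≤ N) (hn : n ≤ N) :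
    |(m : ℝ) ^ c - (n : ℝ) ^ c| ≤ (N : ℝ) ^ c := by
  have h1 : (m : ℝ) ^ c ≤ (N : ℝ) ^ c :=
    Real.rpow_le_rpow (by positivity) (by exact_mod_cast hm) (by linarith)
  have h2 : (n : ℝ) ^ c ≤ (N : ℝ) ^ c :=
    Real.rpow_le_rpow (by positivity) (by exact_mod_cast hn) (by linarith)
  have h3 : (0 : ℝ) ≤ (m : ℝ) ^ c := by positivity
  have h4 : (0 : ℝ) ≤ (n : ℝ) ^ c := by positivity
  rw [abs_le]
  constructor <;> linarith

lemma natLog_two_add_one_le {N : ℕ} (hN : 1 ≤ N) :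
    ((Nat.log 2 N + 1 : ℕ) : ℝ) ≤ 2 * Real.log N + 1 := by
  have hN0 : (0 : ℝ) < N := by exact_mod_cast hN
  have h1 : ((2 : ℝ)) ^ (Nat.log 2 N) ≤ N := by
    exact_mod_cast Nat.pow_log_le_self 2 (by omega)
  have h2 := Real.log_le_log (by positivity) h1
  rw [Real.log_pow] at h2
  have h3 := Real.log_two_gt_d9
  have h4 : (0 : ℝ) ≤ Nat.log 2 N := Nat.cast_nonneg _
  push_cast
  nlinarith

/-- Bilinear sums with both variables large: power saving, uniformly over the coefficients. -/
lemma exists_powerSaving_typeII {c : ℝ} (hc1 : 1 < c) (hc : ∀ m : ℤ, c ≠ m) {α : ℝ} (hα : α ≠ 0) :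
    ∃ b : ℕ → ℝ, PowerSaving b ∧ ∀ᶠ N : ℕ in atTop, ∀ (f g : ℕ → ℝ),
      (∀ d, |f d| ≤ 1) → (∀ m ≤ N, |g m| ≤ Real.log N) →
      (∀ d ≤ ⌊(N : ℝ) ^ (1 / 3 : ℝ)⌋₊, f d = 0) → (∀ m ≤ ⌊(N : ℝ) ^ (1 / 3 : ℝ)⌋₊, g m = 0) →
      ‖∑ d ∈ Finset.Ioc 0 N, (f d : ℂ) * ∑ m ∈ Finset.Ioc 0 (N / d),
        (g m : ℂ) * e (α * ((d * m : ℕ) : ℝ) ^ c)‖ ≤ b N := by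
  have hα0 : 0 < |α| := abs_pos.2 hα
  -- Every block that matters has `M ≥ N ^ (1/6)`, and `|α| ≤ N` eventually, so the frequencies are
  -- at most `N ^ (c + 1) ≤ M ^ (6 (c + 1))`.
  obtain ⟨C, δ, hC, hδ, hδ1, h⟩ := norm_sum_Ico_e_le hc1 hc hα0 (6 * (c + 1))
  refine ⟨fun N => √(2 * (1 + C)) * (2 * (Real.log N * (Real.log N * (N : ℝ) ^ (1 - δ / 6))) +
    Real.log N * (N : ℝ) ^ (1 - δ / 6)), ?_, ?_⟩
  · have h1 : PowerSaving fun N => (N : ℝ) ^ (1 - δ / 6) := powerSaving_rpow (by linarith)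
    exact ((h1.log_mul.log_mul.const_mul 2).add h1.log_mul).const_mul _
  filter_upwards [eventually_ge_atTop 64, eventually_ge_atTop ⌈|α|⌉₊] with N hN hNα
  intro f g hf hg hf0 hg0
  have hN64 : (64 : ℝ) ≤ N := by exact_mod_cast hN
  have hN1 : (1 : ℝ) ≤ N := by linarith
  have hN0 : (0 : ℝ) < N := by linarith
  have hNα' : |α| ≤ N := (Nat.le_ceil _).trans (by exact_mod_cast hNα)
  set X := (N : ℝ) ^ (1 / 3 : ℝ) with hX
  set U := ⌊X⌋₊ with hU
  have hX6 : X = (N : ℝ) ^ (1 / 6 : ℝ) * (N : ℝ) ^ (1 / 6 : ℝ) := by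
    rw [hX, ← Real.rpow_add hN0]; norm_num
  have h6 : 2 ≤ (N : ℝ) ^ (1 / 6 : ℝ) := by
    calc (2 : ℝ) = ((2 : ℝ) ^ (6 : ℝ)) ^ (1 / 6 : ℝ) := by
          rw [← Real.rpow_mul (by norm_num)]; norm_num
      _ ≤ (N : ℝ) ^ (1 / 6 : ℝ) := by
          refine Real.rpow_le_rpow (by positivity) ?_ (by norm_num)
          norm_num; linarith
  have hX4 : 4 ≤ X := by rw [hX6]; nlinarith
  have hX0 : 0 < X := by linarith
  have hU1 : X < U + 1 := Nat.lt_floor_add_one X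
  have hUX : X / 2 ≤ U := by linarith
  have hU0 : (0 : ℝ) < U := by linarith
  have hlog : 0 ≤ Real.log N := Real.log_nonneg hN1
  set Y : ℝ := √(2 * (1 + C)) * (Real.log N * (N : ℝ) ^ (1 - δ / 6)) with hY
  have hY0 : 0 ≤ Y := by positivity
  set G : ℕ → ℂ := fun d => (f d : ℂ) * ∑ m ∈ Finset.Ioc 0 (N / d),
        (g m : ℂ) * e (α * ((d * m : ℕ) : ℝ) ^ c) with hG
  -- A block vanishes if `N / M ≤ U`, since then `g` is zero throughout, or if `2 M ≤ U + 1`, since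
  -- then `f` is. In the remaining blocks `M ≥ X / 2` and `M U ≤ N`: the first gives the saving off
  -- the diagonal, the second the saving on it.
  have hblock : ∀ i, ‖∑ d ∈ Finset.Ico (2 ^ i) (2 * 2 ^ i), G d‖ ≤ Y := by
    intro i
    set M := 2 ^ i with hM
    have hM1 : 1 ≤ M := Nat.one_le_two_pow
    have hM0 : (0 : ℝ) < M := by exact_mod_cast hM1
    rcases Nat.lt_or_ge U (N / M) with hbig | hbig
    swap
    · rw [Finset.sum_eq_zero, norm_zero]
      · exact hY0
      intro d hd
      rw [Finset.mem_Ico] at hd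
      simp only [hG]
      rw [Finset.sum_eq_zero, mul_zero]
      intro m hm
      rw [Finset.mem_Ioc] at hm
      have : N / d ≤ N / M := Nat.div_le_div_left hd.1 (by omega)
      rw [hg0 m (by omega)]
      simp
    rcases Nat.lt_or_ge (U + 1) (2 * M) with hMU | hMU
    swap
    · rw [Finset.sum_eq_zero, norm_zero]
      · exact hY0
      intro d hd
      rw [Finset.mem_Ico] at hd
      simp only [hG]
      rw [hf0 d (by omega)]
      simp
    have hMX : X / 2 ≤ M := by
      have : ((U + 1 : ℕ) : ℝ) ≤ ((2 * M : ℕ) : ℝ) := by exact_mod_cast hMU.le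
      push_cast at this
      linarith
    have hM6 : (N : ℝ) ^ (1 / 6 : ℝ) ≤ M := by
      refine le_trans ?_ hMX
      rw [hX6]; nlinarith
    have hMA : |α| * (N : ℝ) ^ c ≤ (M : ℝ) ^ (6 * (c + 1)) := by
      calc |α| * (N : ℝ) ^ c ≤ N * (N : ℝ) ^ c := by gcongr
        _ = ((N : ℝ) ^ (1 / 6 : ℝ)) ^ (6 * (c + 1)) := by
            rw [← Real.rpow_mul hN0.le, ← Real.rpow_one_add' hN0.le (by linarith)]
            congr 1; ring
        _ ≤ _ := Real.rpow_le_rpow (by positivity) hM6 (by linarith)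
    have hMN : (M : ℝ) * U ≤ N := by
      have h1 : U * M ≤ N := (Nat.le_div_iff_mul_le (by omega)).1 hbig.le
      rw [mul_comm]; exact_mod_cast h1
    have hb := norm_sq_bilinear_block_le α c f g N M hM1 (L := Real.log N)
      (E := C * (M : ℝ) ^ (1 - δ)) (by positivity) hf hg (by
        intro m₁ h₁ m₂ h₂ hne b hbM
        rw [Finset.mem_Ioc] at h₁ h₂
        have hle : N / M ≤ N := Nat.div_le_self _ _
        refine h M _ hM1 ?_ ?_ M b le_rfl hbM
        · rw [abs_mul]
          exact le_mul_of_one_le_right hα0.le (one_le_abs_rpow_sub_rpow hc1 hne)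
        · rw [abs_mul]
          refine le_trans ?_ hMA
          exact mul_le_mul_of_nonneg_left
            (abs_rpow_sub_rpow_le hc1 (by omega) (by omega)) hα0.le)
    have hNδ : X ^ (-δ) = (N : ℝ) ^ (-(δ / 3)) := by
      rw [hX, ← Real.rpow_mul hN0.le]; congr 1; ring
    have e1 : (N : ℝ) * M ≤ N ^ 2 * (2 * (N : ℝ) ^ (-(δ / 3))) := by
      have h1 : (M : ℝ) ≤ N * (2 * (N : ℝ) ^ (-(δ / 3))) := by
        have h2 : (M : ℝ) ≤ N * (2 / X) := by
          rw [mul_div_assoc', le_div_iff₀ hX0]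
          nlinarith
        refine h2.trans (mul_le_mul_of_nonneg_left ?_ hN0.le)
        rw [← hNδ, div_eq_mul_inv, ← Real.rpow_neg_one X]
        refine mul_le_mul_of_nonneg_left ?_ (by norm_num)
        exact Real.rpow_le_rpow_of_exponent_le (by linarith) (by linarith)
      calc (N : ℝ) * M ≤ N * (N * (2 * (N : ℝ) ^ (-(δ / 3)))) := by gcongr
        _ = _ := by ring
    have e2 : C * (M : ℝ) ^ (1 - δ) / M ≤ C * (2 * (N : ℝ) ^ (-(δ / 3))) := by
      have h1 : (M : ℝ) ^ (1 - δ) / M = (M : ℝ) ^ (-δ) := by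
        rw [← Real.rpow_sub_one hM0.ne']; congr 1; ring
      rw [mul_div_assoc, h1]
      refine mul_le_mul_of_nonneg_left ?_ hC
      calc (M : ℝ) ^ (-δ) ≤ (X / 2) ^ (-δ) :=
            Real.rpow_le_rpow_of_nonpos (by positivity) hMX (by linarith)
        _ = X ^ (-δ) * 2 ^ δ := by
            rw [Real.div_rpow hX0.le (by norm_num), Real.rpow_neg (by norm_num : (0 : ℝ) ≤ 2),
              div_inv_eq_mul]
        _ ≤ X ^ (-δ) * 2 ^ (1 : ℝ) := by
            refine mul_le_mul_of_nonneg_left ?_ (by positivity)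
            exact Real.rpow_le_rpow_of_exponent_le (by norm_num) hδ1.le
        _ = _ := by rw [hNδ, Real.rpow_one]; ring
    have hfin : ‖∑ d ∈ Finset.Ico M (2 * M), G d‖ ^ 2 ≤ Y ^ 2 := by
      refine hb.trans ?_
      calc Real.log N ^ 2 * ((N : ℝ) * M + (N : ℝ) ^ 2 * (C * (M : ℝ) ^ (1 - δ) / M))
          ≤ Real.log N ^ 2 * (N ^ 2 * (2 * (N : ℝ) ^ (-(δ / 3))) +
              (N : ℝ) ^ 2 * (C * (2 * (N : ℝ) ^ (-(δ / 3))))) := by gcongr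
        _ = 2 * (1 + C) * (Real.log N ^ 2 * (N ^ 2 * (N : ℝ) ^ (-(δ / 3)))) := by ring
        _ = _ := by
            rw [hY, mul_pow, Real.sq_sqrt (by positivity), mul_pow,
              ← Real.rpow_mul_natCast hN0.le, ← Real.rpow_natCast (N : ℝ) 2, ← Real.rpow_add hN0]
            congr 3
            push_cast
            ring
    exact le_of_sq_le_sq hfin hY0
  set K := Nat.log 2 N + 1 with hK
  have hNK : N < 2 ^ K := Nat.lt_pow_succ_log_self (by norm_num) N
  -- Passing to a full union of dyadic blocks is free, because the inner sum is empty for `d > N`.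
  have hext : ∑ d ∈ Finset.Ioc 0 N, G d = ∑ d ∈ Finset.Ico 1 (2 ^ K), G d := by
    refine Finset.sum_subset ?_ ?_
    · intro d hd
      rw [Finset.mem_Ioc] at hd
      rw [Finset.mem_Ico]
      omega
    · intro d hd hd'
      rw [Finset.mem_Ico] at hd
      rw [Finset.mem_Ioc] at hd'
      simp only [hG]
      rw [Nat.div_eq_of_lt (by omega)]
      simp
  rw [hext, sum_Ico_two_pow]
  calc _ ≤ ∑ i ∈ Finset.range K, Y := (norm_sum_le _ _).trans (Finset.sum_le_sum fun i _ => hblock i)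
    _ = K * Y := by simp
    _ ≤ (2 * Real.log N + 1) * Y :=
        mul_le_mul_of_nonneg_right (natLog_two_add_one_le (by omega)) hY0
    _ = _ := by rw [hY]; ring

/-! ### Exponential sums over primes -/

/-- Power saving in the sum of `e (α n ^ c)` weighted by the von Mangoldt function. -/
theorem powerSaving_sum_vonMangoldt {c : ℝ} (hc1 : 1 < c) (hc : ∀ m : ℤ, c ≠ m) {α : ℝ}
    (hα : α ≠ 0) :
    PowerSaving fun N => ‖∑ n ∈ Finset.Ioc 0 N, (vonMangoldt n : ℂ) * e (α * (n : ℝ) ^ c)‖ := by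
  obtain ⟨b₁, hb₁, h₁⟩ := exists_powerSaving_typeI hc1 hc hα
  obtain ⟨b₂, hb₂, h₂⟩ := exists_powerSaving_typeII hc1 hc hα
  have hsum : PowerSaving fun N => Real.log N * (N : ℝ) ^ (1 / 3 : ℝ) +
      (2 * (Real.log N * b₁ N) + b₂ N) :=
    (powerSaving_rpow (by norm_num : (1 / 3 : ℝ) < 1)).log_mul.add
      ((hb₁.log_mul.const_mul 2).add hb₂)
  refine hsum.of_le ?_
  filter_upwards [h₂, eventually_ge_atTop 1] with N h₂ hN
  have hN1 : (1 : ℝ) ≤ N := by exact_mod_cast hN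
  have hN0 : (0 : ℝ) < N := by linarith
  have hlog : 0 ≤ Real.log N := Real.log_nonneg hN1
  rw [abs_norm]
  -- With the cutoff at `N ^ (1/3)`, the convolution of the two truncated functions is supported up
  -- to `U * U ≤ N ^ (2/3)`, within reach of the type I bound. In the last term of Vaughan's
  -- identity both variables exceed `U`, as the type II bound requires.
  set U := ⌊(N : ℝ) ^ (1 / 3 : ℝ)⌋₊ with hU
  have hUX : (U : ℝ) ≤ (N : ℝ) ^ (1 / 3 : ℝ) := Nat.floor_le (by positivity)
  have hrp : ∀ s : ℝ, s ≤ 1 → (N : ℝ) ^ s ≤ N := fun s hs => by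
    calc (N : ℝ) ^ s ≤ (N : ℝ) ^ (1 : ℝ) := Real.rpow_le_rpow_of_exponent_le hN1 hs
      _ = N := Real.rpow_one _
  have hUU : ((U * U : ℕ) : ℝ) ≤ (N : ℝ) ^ (2 / 3 : ℝ) := by
    push_cast
    calc (U : ℝ) * U ≤ (N : ℝ) ^ (1 / 3 : ℝ) * (N : ℝ) ^ (1 / 3 : ℝ) := by gcongr
      _ = _ := by rw [← Real.rpow_add hN0]; norm_num
  have hU23 : (U : ℝ) ≤ (N : ℝ) ^ (2 / 3 : ℝ) :=
    hUX.trans (Real.rpow_le_rpow_of_exponent_le hN1 (by norm_num))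
  have hUN : U ≤ N := by exact_mod_cast hU23.trans (hrp _ (by norm_num))
  have hUUN : U * U ≤ N := by exact_mod_cast hUU.trans (hrp _ (by norm_num))
  have hlogle : ∀ n ≤ N, Real.log n ≤ Real.log N := by
    intro n hn
    rcases Nat.eq_zero_or_pos n with rfl | hn0
    · simpa using hlog
    · exact Real.log_le_log (by exact_mod_cast hn0) (by exact_mod_cast hn)
  set F : ℕ → ℂ := fun n => e (α * (n : ℝ) ^ c) with hF
  have hdecomp : ∑ n ∈ Finset.Ioc 0 N, (vonMangoldt n : ℂ) * F n =
      ∑ n ∈ Finset.Ioc 0 N, (restrictLE vonMangoldt U n : ℂ) * F n +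
      ∑ n ∈ Finset.Ioc 0 N, ((restrictLE (moebius : ArithmeticFunction ℝ) U *
        ArithmeticFunction.log) n : ℂ) * F n -
      ∑ n ∈ Finset.Ioc 0 N, ((restrictLE (moebius : ArithmeticFunction ℝ) U *
        restrictLE vonMangoldt U * (zeta : ArithmeticFunction ℝ)) n : ℂ) * F n +
      ∑ n ∈ Finset.Ioc 0 N, ((restrictGT (moebius : ArithmeticFunction ℝ) U *
        (restrictGT vonMangoldt U * (zeta : ArithmeticFunction ℝ))) n : ℂ) * F n := by
    rw [← Finset.sum_add_distrib, ← Finset.sum_sub_distrib, ← Finset.sum_add_distrib]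
    refine Finset.sum_congr rfl fun n _ => ?_
    have hv := congrArg (fun f : ArithmeticFunction ℝ => ((f n : ℝ) : ℂ)) (vaughan_identity U)
    simp only [ArithmeticFunction.add_apply, Complex.ofReal_add] at hv
    linear_combination F n * hv
  have hS0 : ‖∑ n ∈ Finset.Ioc 0 N, (restrictLE vonMangoldt U n : ℂ) * F n‖ ≤
      Real.log N * (N : ℝ) ^ (1 / 3 : ℝ) := by
    rw [← Finset.sum_subset (Finset.Ioc_subset_Ioc_right hUN) (by
      intro n hn hn'
      rw [Finset.mem_Ioc] at hn hn'
      rw [restrictLE_apply, if_neg (by omega)]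
      simp)]
    calc _ ≤ ∑ n ∈ Finset.Ioc 0 U, Real.log N := by
          refine (norm_sum_le _ _).trans (Finset.sum_le_sum fun n hn => ?_)
          rw [Finset.mem_Ioc] at hn
          rw [norm_mul, norm_e, mul_one, Complex.norm_real, Real.norm_eq_abs]
          exact (abs_restrictLE_vonMangoldt_le U n).trans
            (vonMangoldt_le_log.trans (hlogle n (by omega)))
      _ = U * Real.log N := by simp
      _ ≤ _ := by rw [mul_comm]; gcongr
  have hS1 : ‖∑ n ∈ Finset.Ioc 0 N, ((restrictLE (moebius : ArithmeticFunction ℝ) U *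
        ArithmeticFunction.log) n : ℂ) * F n‖ ≤ Real.log N * b₁ N := by
    rw [sum_Ioc_mul_apply]
    have := h₁ N U 1 (restrictLE (moebius : ArithmeticFunction ℝ) U) (fun n => Real.log n) hN
      hU23 hUN (fun d _ => abs_restrictLE_moebius_le U d)
      (fun d hd => by rw [restrictLE_apply, if_neg (by omega)])
      (by
        intro m n hmn
        rcases Nat.eq_zero_or_pos m with rfl | hm
        · simpa using Real.log_natCast_nonneg n
        · exact Real.log_le_log (by exact_mod_cast hm) (by exact_mod_cast hmn)) (by simp)
    rw [one_mul] at this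
    exact this
  have hS2 : ‖∑ n ∈ Finset.Ioc 0 N, ((restrictLE (moebius : ArithmeticFunction ℝ) U *
        restrictLE vonMangoldt U * (zeta : ArithmeticFunction ℝ)) n : ℂ) * F n‖ ≤
      Real.log N * b₁ N := by
    rw [sum_Ioc_mul_apply]
    have := h₁ N (U * U) (Real.log N) (restrictLE (moebius : ArithmeticFunction ℝ) U *
        restrictLE vonMangoldt U : ArithmeticFunction ℝ) (fun _ => 1) hN hUU hUUN
      (fun d hd => (abs_mul_le_log (abs_restrictLE_moebius_le U)
        (abs_restrictLE_vonMangoldt_le U) d).trans (hlogle d hd))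
      (fun d hd => restrictLE_mul_restrictLE_eq_zero _ _ hd) monotone_const zero_le_one
    rw [mul_one] at this
    refine le_trans (le_of_eq ?_) this
    congr 1
    refine Finset.sum_congr rfl fun d _ => ?_
    congr 1
    refine Finset.sum_congr rfl fun m hm => ?_
    rw [Finset.mem_Ioc] at hm
    rw [natCoe_apply, zeta_apply_ne (by omega)]
    simp [hF]
  have hS3 : ‖∑ n ∈ Finset.Ioc 0 N, ((restrictGT (moebius : ArithmeticFunction ℝ) U *
        (restrictGT vonMangoldt U * (zeta : ArithmeticFunction ℝ))) n : ℂ) * F n‖ ≤ b₂ N := by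
    rw [sum_Ioc_mul_apply]
    refine h₂ _ _ (abs_restrictGT_moebius_le U) (fun m hm => ?_)
      (fun d hd => by rw [restrictGT_apply, if_pos hd])
      (fun m hm => restrictGT_mul_eq_zero _ _ hm)
    rw [mul_comm]
    exact (abs_mul_le_log abs_zeta_le (abs_restrictGT_vonMangoldt_le U) m).trans (hlogle m hm)
  rw [hdecomp]
  refine (norm_add_le _ _).trans ?_
  have t1 := norm_sub_le
    (∑ n ∈ Finset.Ioc 0 N, (restrictLE vonMangoldt U n : ℂ) * F n +
      ∑ n ∈ Finset.Ioc 0 N, ((restrictLE (moebius : ArithmeticFunction ℝ) U *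
        ArithmeticFunction.log) n : ℂ) * F n)
    (∑ n ∈ Finset.Ioc 0 N, ((restrictLE (moebius : ArithmeticFunction ℝ) U *
        restrictLE vonMangoldt U * (zeta : ArithmeticFunction ℝ)) n : ℂ) * F n)
  have t2 := norm_add_le (∑ n ∈ Finset.Ioc 0 N, (restrictLE vonMangoldt U n : ℂ) * F n)
    (∑ n ∈ Finset.Ioc 0 N, ((restrictLE (moebius : ArithmeticFunction ℝ) U *
        ArithmeticFunction.log) n : ℂ) * F n)
  linarith

lemma powerSaving_const (k : ℝ) : PowerSaving fun _ => k := by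
  simpa using (powerSaving_rpow (by norm_num : (0 : ℝ) < 1)).const_mul k

/-- Summation by parts needs one bound for all partial sums up to `N`, including short ones that the
asymptotic estimate does not see; these go into an additive constant. Capping the saving at `1/2`
keeps the exponent positive, so that the bound increases with `N`. -/
lemma PowerSaving.exists_forall_le {f : ℕ → ℝ} (hf : PowerSaving f) :
    ∃ g, PowerSaving g ∧ ∀ N, 1 ≤ N → ∀ j ≤ N, f j ≤ g N := by
  obtain ⟨δ, hδ, hf⟩ := hf
  have hf' := hf.trans (isBigO_natCast_rpow_of_le (by linarith [min_le_left δ (1 / 2)] :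
    1 - δ ≤ 1 - min δ (1 / 2)))
  set η := min δ (1 / 2) with hη
  have hη0 : 0 < η := lt_min hδ (by norm_num)
  have hη1 : η ≤ 1 / 2 := min_le_right _ _
  obtain ⟨C, hC0, hC⟩ := hf'.exists_pos
  obtain ⟨n₀, hn₀⟩ := eventually_atTop.1 hC.bound
  refine ⟨fun N => C * (N : ℝ) ^ (1 - η) + ∑ j ∈ Finset.range n₀, |f j|,
    ((powerSaving_rpow (by linarith)).const_mul C).add (powerSaving_const _), ?_⟩
  intro N hN j hj
  have hs : 0 ≤ ∑ j ∈ Finset.range n₀, |f j| := Finset.sum_nonneg fun _ _ => abs_nonneg _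
  rcases Nat.lt_or_ge j n₀ with h | h
  · have h1 : |f j| ≤ ∑ j ∈ Finset.range n₀, |f j| :=
      Finset.single_le_sum (f := fun j => |f j|) (fun _ _ => abs_nonneg _) (Finset.mem_range.2 h)
    have h2 : 0 ≤ C * (N : ℝ) ^ (1 - η) := by positivity
    linarith [le_abs_self (f j)]
  · have h1 := hn₀ j h
    rw [Real.norm_eq_abs, Real.norm_of_nonneg (by positivity)] at h1
    have h2 : C * (j : ℝ) ^ (1 - η) ≤ C * (N : ℝ) ^ (1 - η) := by
      gcongr
      linarith
    linarith [le_abs_self (f j)]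

/-- Power saving in the sum of `e (α p ^ c)` over primes, weighted by `log p`. -/
lemma powerSaving_sum_log_prime {c : ℝ} (hc1 : 1 < c) (hc : ∀ m : ℤ, c ≠ m) {α : ℝ}
    (hα : α ≠ 0) :
    PowerSaving fun N => ‖∑ n ∈ Finset.Ioc 0 N,
      ((if n.Prime then Real.log n else 0 : ℝ) : ℂ) * e (α * (n : ℝ) ^ c)‖ := by
  have h1 := powerSaving_sum_vonMangoldt hc1 hc hα
  have h2 : PowerSaving fun N => 2 * (Real.log N * (N : ℝ) ^ (1 / 2 : ℝ)) :=
    (powerSaving_rpow (by norm_num : (1 / 2 : ℝ) < 1)).log_mul.const_mul 2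
  refine (h1.add h2).of_le ?_
  filter_upwards [eventually_ge_atTop 1] with N hN
  have hN1 : (1 : ℝ) ≤ N := by exact_mod_cast hN
  rw [abs_norm]
  have h3 : ∑ n ∈ Finset.Ioc 0 N, ((if n.Prime then Real.log n else 0 : ℝ) : ℂ) *
      e (α * (n : ℝ) ^ c) = ∑ n ∈ Finset.Ioc 0 N, (vonMangoldt n : ℂ) * e (α * (n : ℝ) ^ c) -
      ∑ n ∈ (Finset.Ioc 0 N).filter (fun n => ¬ n.Prime),
        (vonMangoldt n : ℂ) * e (α * (n : ℝ) ^ c) := by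
    rw [Finset.sum_filter, ← Finset.sum_sub_distrib]
    refine Finset.sum_congr rfl fun n _ => ?_
    by_cases h : n.Prime
    · simp [h, vonMangoldt_apply_prime h]
    · simp [h]
  -- Only proper prime powers contribute, and their total weight is `ψ(N) - θ(N)`, of order at most
  -- `√N log N`.
  have h4 : ‖∑ n ∈ (Finset.Ioc 0 N).filter (fun n => ¬ n.Prime),
      (vonMangoldt n : ℂ) * e (α * (n : ℝ) ^ c)‖ ≤ 2 * (Real.log N * (N : ℝ) ^ (1 / 2 : ℝ)) := by
    have h5 := Chebyshev.psi_sub_theta_eq_sum_not_prime (N : ℝ)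
    have h6 := Chebyshev.psi_sub_theta_le hN1
    rw [h5, Nat.floor_natCast] at h6
    refine (norm_sum_le _ _).trans (le_trans (le_of_eq ?_) (h6.trans (le_of_eq ?_)))
    · refine Finset.sum_congr rfl fun n _ => ?_
      rw [norm_mul, norm_e, mul_one, Complex.norm_real, Real.norm_of_nonneg vonMangoldt_nonneg]
    · rw [Real.sqrt_eq_rpow]; ring
  rw [h3]
  exact (norm_sub_le _ _).trans (add_le_add le_rfl h4)

/-- Power saving in the sum of `e (α p ^ c)` over primes. -/
theorem powerSaving_sum_prime {c : ℝ} (hc1 : 1 < c) (hc : ∀ m : ℤ, c ≠ m) {α : ℝ}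
    (hα : α ≠ 0) :
    PowerSaving fun N => ‖∑ p ∈ (Finset.Ioc 0 N).filter Nat.Prime, e (α * (p : ℝ) ^ c)‖ := by
  obtain ⟨g, hg, hle⟩ := (powerSaving_sum_log_prime hc1 hc hα).exists_forall_le
  refine (hg.const_mul (1 / Real.log 2)).of_le ?_
  filter_upwards [eventually_ge_atTop 1] with N hN
  rw [abs_norm]
  -- The maximum with 2 keeps the weight positive and antitone at 0 and 1 and changes nothing on the
  -- primes.
  set w : ℕ → ℝ := fun n => 1 / Real.log (max n 2 : ℕ) with hw
  have hl2 : ∀ n : ℕ, 0 < Real.log (max n 2 : ℕ) := fun n =>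
    Real.log_pos (by exact_mod_cast (by omega : 1 < max n 2))
  have hanti : Antitone w := by
    intro m n hmn
    simp only [hw]
    refine one_div_le_one_div_of_le (hl2 m) (Real.log_le_log ?_ ?_)
    · exact_mod_cast (by omega : 0 < max m 2)
    · exact_mod_cast (by omega : max m 2 ≤ max n 2)
  have h1 := norm_sum_mul_le_of_antitone hanti (fun n => (one_div_pos.2 (hl2 n)).le)
    (fun n => ((if n.Prime then Real.log n else 0 : ℝ) : ℂ) * e (α * (n : ℝ) ^ c)) N (hle N hN)
  have h2 : w 0 = 1 / Real.log 2 := by simp [hw]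
  rw [h2] at h1
  refine le_trans (le_of_eq ?_) h1
  rw [Finset.sum_filter]
  congr 1
  refine Finset.sum_congr rfl fun n _ => ?_
  by_cases hp : n.Prime
  · have h3 : max n 2 = n := by have := hp.two_le; omega
    have h4 : Real.log n ≠ 0 := by have := hl2 n; rw [h3] at this; exact this.ne'
    have h5 : (w n : ℂ) * ((Real.log n : ℝ) : ℂ) = 1 := by
      simp only [hw]
      rw [h3, ← Complex.ofReal_mul, one_div_mul_cancel h4, Complex.ofReal_one]
    rw [if_pos hp, if_pos hp, ← mul_assoc, h5, one_mul]
  · simp [hp]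

lemma sum_range_nth_prime {E : Type*} [AddCommMonoid E] (F : ℕ → E) (N : ℕ) :
    ∑ n ∈ Finset.range (N + 1), F (Nat.nth Nat.Prime n) =
      ∑ p ∈ (Finset.Ioc 0 (Nat.nth Nat.Prime N)).filter Nat.Prime, F p := by
  have hinf := Nat.infinite_setOfPred_prime
  refine Finset.sum_bij (fun n _ => Nat.nth Nat.Prime n) ?_ ?_ ?_ fun _ _ => rfl
  · intro n hn
    rw [Finset.mem_range] at hn
    have hp := Nat.nth_mem_of_infinite hinf n
    rw [Finset.mem_filter, Finset.mem_Ioc]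
    exact ⟨⟨hp.pos, (Nat.nth_le_nth hinf).2 (by omega)⟩, hp⟩
  · intro m _ n _ h
    exact Nat.nth_injective hinf h
  · intro p hp
    rw [Finset.mem_filter, Finset.mem_Ioc] at hp
    refine ⟨Nat.count Nat.Prime p, ?_, Nat.nth_count hp.2⟩
    rw [Finset.mem_range, Nat.lt_succ_iff, ← Nat.nth_le_nth hinf, Nat.nth_count hp.2]
    exact hp.1.2

/-- Chebyshev's lower bound for `ψ`, combined with `ψ(x) ≤ π(x) log x`. The gap between `log 2` and
`1/2` absorbs the logarithmic loss for large `x`. -/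
lemma eventually_natCast_le_primeCounting_mul_log :
    ∀ᶠ x : ℕ in atTop, (x : ℝ) ≤ 2 * (Nat.primeCounting x * Real.log x) := by
  have h1 : ∀ᶠ x : ℕ in atTop, Real.log x ≤ 1 / 100 * x := by
    have := (Real.isLittleO_log_id_atTop.comp_tendsto tendsto_natCast_atTop_atTop).bound
      (by norm_num : (0 : ℝ) < 1 / 100)
    filter_upwards [this] with x hx
    simp only [Function.comp_apply, id, Real.norm_eq_abs, Nat.abs_cast] at hx
    exact (le_abs_self _).trans hx
  filter_upwards [h1, eventually_ge_atTop 100] with x hx hx1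
  have h2 := (Chebyshev.psi_ge x).trans (Chebyshev.psi_le_primeCounting_mul_log x)
  have hx100 : (100 : ℝ) ≤ x := by exact_mod_cast hx1
  have h3 : Real.log (x + 1) ≤ Real.log x + 1 := by
    have : (x : ℝ) + 1 ≤ x * 2 := by linarith
    calc Real.log (x + 1) ≤ Real.log (x * 2) := Real.log_le_log (by linarith) this
      _ = Real.log x + Real.log 2 := Real.log_mul (by linarith) (by norm_num)
      _ ≤ _ := by linarith [Real.log_two_lt_d9]
  have h4 := Real.log_two_gt_d9
  nlinarith

/-- A function with power saving is negligible against the prime counting function. -/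
lemma PowerSaving.tendsto_div_primeCounting {f : ℕ → ℝ} (hf : PowerSaving f) :
    Tendsto (fun x => f x / Nat.primeCounting x) atTop (𝓝 0) := by
  obtain ⟨δ, hδ, h⟩ := hf.log_mul
  obtain ⟨C, hC0, hC⟩ := h.exists_pos
  have hlim : Tendsto (fun x : ℕ => 2 * C * (x : ℝ) ^ (-δ)) atTop (𝓝 0) := by
    have := (tendsto_rpow_neg_atTop hδ).comp (tendsto_natCast_atTop_atTop (R := ℝ))
    simpa using this.const_mul (2 * C)
  refine squeeze_zero_norm' ?_ hlim
  filter_upwards [hC.bound, eventually_natCast_le_primeCounting_mul_log,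
    eventually_ge_atTop 2] with x h1 h2 h3
  have hx2 : (2 : ℝ) ≤ x := by exact_mod_cast h3
  have hx0 : (0 : ℝ) < x := by linarith
  have hlog : 0 < Real.log x := Real.log_pos (by linarith)
  have hpi : (0 : ℝ) < Nat.primeCounting x := by
    by_contra hcon
    have h0 : (Nat.primeCounting x : ℝ) ≤ 0 := not_lt.1 hcon
    nlinarith
  rw [Real.norm_eq_abs, Real.norm_of_nonneg (by positivity), abs_mul, abs_of_pos hlog] at h1
  rw [norm_div, Real.norm_eq_abs, Real.norm_of_nonneg hpi.le, div_le_iff₀ hpi]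
  have h5 : (x : ℝ) ^ (1 - δ) = x * (x : ℝ) ^ (-δ) := by
    rw [sub_eq_add_neg, Real.rpow_add hx0, Real.rpow_one]
  rw [h5] at h1
  have h6 : Real.log x * |f x| ≤ Real.log x * (2 * C * (x : ℝ) ^ (-δ) * Nat.primeCounting x) := by
    refine h1.trans ?_
    calc C * (x * (x : ℝ) ^ (-δ)) ≤
          C * ((2 * (Nat.primeCounting x * Real.log x)) * (x : ℝ) ^ (-δ)) := by gcongr
      _ = _ := by ring
  exact le_of_mul_le_mul_left h6 hlog

/-- The exponential sums over the first `N` primes are `o(N)`. -/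
theorem tendsto_mean_e_prime {c : ℝ} (hc1 : 1 < c) (hc : ∀ m : ℤ, c ≠ m) {α : ℝ} (hα : α ≠ 0) :
    Tendsto (fun N : ℕ => (∑ n ∈ Finset.range N, e (α * (Nat.nth Nat.Prime n : ℝ) ^ c)) / N)
      atTop (𝓝 0) := by
  -- The shift by one matters: `Nat.nth` counts from 0, so the primes up to the `N`-th one number `N
  -- + 1`, and the mean over them is the prime sum at that prime divided by its prime counting
  -- function.
  rw [← tendsto_add_atTop_iff_nat 1, tendsto_zero_iff_norm_tendsto_zero]
  have hinf := Nat.infinite_setOfPred_prime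
  have h1 := (powerSaving_sum_prime hc1 hc hα).tendsto_div_primeCounting.comp
    (Nat.nth_strictMono hinf).tendsto_atTop
  refine h1.congr fun N => ?_
  simp only [Function.comp_apply]
  rw [sum_range_nth_prime (fun p => e (α * (p : ℝ) ^ c)), norm_div, Complex.norm_natCast,
    Nat.primeCounting, Nat.primeCounting', Nat.count_nth_succ_of_infinite hinf]

/-! ### Weyl's criterion and equidistribution in residue classes -/

open MeasureTheory

lemma fourier_eq_e (m : ℤ) (x : ℝ) : fourier m (x : AddCircle (1 : ℝ)) = e (m * x) := by
  rw [fourier_coe_apply, e]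
  congr 1
  push_cast
  ring

lemma norm_sum_div_le {b : ℕ → ℂ} {B : ℝ} (hB : 0 ≤ B) (hb : ∀ n, ‖b n‖ ≤ B) (N : ℕ) :
    ‖(∑ n ∈ Finset.range N, b n) / N‖ ≤ B := by
  rw [norm_div, Complex.norm_natCast]
  refine div_le_of_le_mul₀ (Nat.cast_nonneg N) hB ?_
  refine (norm_sum_le _ _).trans ((Finset.sum_le_sum fun n _ => hb n).trans ?_)
  simp [mul_comm]

/-- The Weyl criterion for continuous functions on the circle. -/
theorem tendsto_mean_of_weyl {x : ℕ → ℝ} (hx : ∀ m : ℤ, m ≠ 0 →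
      Tendsto (fun N : ℕ => (∑ n ∈ Finset.range N, e (m * x n)) / N) atTop (𝓝 0))
    (g : C(AddCircle (1 : ℝ), ℂ)) :
    Tendsto (fun N : ℕ => (∑ n ∈ Finset.range N, g (x n)) / N) atTop (𝓝 (∫ t, g t)) := by
  have hint : ∀ f : C(AddCircle (1 : ℝ), ℂ), Integrable f volume := fun f =>
    f.continuous.integrable_of_hasCompactSupport (HasCompactSupport.of_compactSpace f)
  have hvol : (volume : Measure (AddCircle (1 : ℝ))).real Set.univ = 1 := by
    simp [Measure.real, AddCircle.measure_univ]
  have hspan : ∀ f ∈ Submodule.span ℂ (Set.range <| @fourier (1 : ℝ)),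
      Tendsto (fun N : ℕ => (∑ n ∈ Finset.range N, f (x n)) / N) atTop (𝓝 (∫ t, f t)) := by
    intro f hf
    induction hf using Submodule.span_induction with
    | mem f hf =>
      obtain ⟨m, rfl⟩ := hf
      rcases eq_or_ne m 0 with rfl | hm
      · have h1 : ∫ t : AddCircle (1 : ℝ), (fourier 0 t : ℂ) = 1 := by
          simp [hvol]
        rw [h1]
        refine tendsto_const_nhds.congr' ?_
        filter_upwards [eventually_gt_atTop 0] with N hN
        have : (N : ℂ) ≠ 0 := by exact_mod_cast hN.ne'
        simp [this]
      · have h1 : ∫ t : AddCircle (1 : ℝ), (fourier m t : ℂ) = 0 :=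
          integral_eq_zero_of_add_right_eq_neg (fourier_add_half_inv_index hm one_pos)
        rw [h1]
        simpa only [fourier_eq_e] using hx m hm
    | zero => simp
    | add f g _ _ hf hg =>
      have := hf.add hg
      rw [← integral_add (hint f) (hint g)] at this
      refine this.congr fun N => ?_
      simp only [ContinuousMap.add_apply, Finset.sum_add_distrib, add_div]
    | smul k f _ hf =>
      have := hf.const_mul k
      rw [← integral_const_mul] at this
      refine this.congr fun N => ?_
      simp only [ContinuousMap.smul_apply, smul_eq_mul, ← Finset.mul_sum, mul_div_assoc]
  -- Trigonometric polynomials are uniformly dense, and both the means and the integral are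
  -- contractions for the uniform norm, so convergence passes to `g`.
  have hcl : g ∈ closure (Submodule.span ℂ (Set.range <| @fourier (1 : ℝ)) : Set _) := by
    rw [← Submodule.topologicalClosure_coe, span_fourier_closure_eq_top]
    trivial
  rw [Metric.tendsto_atTop]
  intro ε hε
  obtain ⟨f, hf, hgf⟩ := Metric.mem_closure_iff.1 hcl (ε / 3) (by linarith)
  obtain ⟨N₀, hN₀⟩ := Metric.tendsto_atTop.1 (hspan f hf) (ε / 3) (by linarith)
  refine ⟨N₀, fun N hN => ?_⟩
  have h1 := hN₀ N hN
  rw [dist_eq_norm] at h1 hgf ⊢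
  have hpt : ∀ t, ‖g t - f t‖ ≤ ‖g - f‖ := fun t => (g - f).norm_coe_le_norm t
  have h2 : ‖(∑ n ∈ Finset.range N, (g (x n) - f (x n))) / N‖ ≤ ‖g - f‖ :=
    norm_sum_div_le (norm_nonneg _) (fun n => hpt _) N
  have h3 : ‖∫ t : AddCircle (1 : ℝ), (g t - f t)‖ ≤ ‖g - f‖ := by
    have := norm_integral_le_of_norm_le_const (μ := (volume : Measure (AddCircle (1 : ℝ))))
      (f := fun t => g t - f t) (C := ‖g - f‖) (Eventually.of_forall hpt)
    simpa [hvol] using this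
  have h4 : (∑ n ∈ Finset.range N, g (x n)) / (N : ℂ) - ∫ t, g t =
      (∑ n ∈ Finset.range N, (g (x n) - f (x n))) / N +
      ((∑ n ∈ Finset.range N, f (x n)) / N - ∫ t, f t) - ∫ t, (g t - f t) := by
    rw [integral_sub (hint g) (hint f), Finset.sum_sub_distrib]
    ring
  rw [h4]
  refine (norm_sub_le _ _).trans_lt ?_
  have := norm_add_le ((∑ n ∈ Finset.range N, (g (x n) - f (x n))) / (N : ℂ))
    ((∑ n ∈ Finset.range N, f (x n)) / N - ∫ t, f t)
  linarith

/-- A sequence satisfying the Weyl criterion visits an open subset of the circle with at least the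
expected frequency. -/
lemma eventually_le_card_of_isOpen {x : ℕ → ℝ} (hx : ∀ m : ℤ, m ≠ 0 →
      Tendsto (fun N : ℕ => (∑ n ∈ Finset.range N, e (m * x n)) / N) atTop (𝓝 0))
    {U : Set (AddCircle (1 : ℝ))} (hU : IsOpen U) {r : ℝ} (hr : 0 ≤ r)
    (hrU : ENNReal.ofReal r < volume U) {P : ℕ → Prop} [DecidablePred P]
    (hP : ∀ n, (x n : AddCircle (1 : ℝ)) ∈ U → P n) :
    ∀ᶠ N : ℕ in atTop, r * N ≤ ((Finset.range N).filter P).card := by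
  -- The measure of an open set is the supremum of the integrals of continuous functions with values
  -- in `[0, 1]` that vanish off the set. A function with integral above `r` bounds the indicator
  -- from below, which gives the one-sided estimate.
  rw [hU.measure_eq_biSup_integral_continuous] at hrU
  simp only [lt_iSup_iff] at hrU
  obtain ⟨f, hf, hfU, hf0, hf1, hlt⟩ := hrU
  have hlt' : r < ∫ t, f t := (ENNReal.ofReal_lt_ofReal_iff_of_nonneg hr).1 hlt
  have h1 := tendsto_mean_of_weyl hx ⟨fun t => (f t : ℂ), by fun_prop⟩
  simp only [ContinuousMap.coe_mk] at h1
  rw [integral_complex_ofReal] at h1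
  have h2 : Tendsto (fun N : ℕ => (∑ n ∈ Finset.range N, f (x n)) / (N : ℝ)) atTop
      (𝓝 (∫ t, f t)) := by
    have := (Complex.continuous_re.tendsto _).comp h1
    rw [Complex.ofReal_re] at this
    refine this.congr fun N => ?_
    simp only [Function.comp_apply]
    rw [← Complex.ofReal_re ((∑ n ∈ Finset.range N, f (x n)) / (N : ℝ))]
    push_cast
    rfl
  filter_upwards [h2.eventually_const_lt hlt', eventually_gt_atTop 0] with N hN hN0
  have hN0' : (0 : ℝ) < N := by exact_mod_cast hN0
  rw [lt_div_iff₀ hN0'] at hN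
  refine hN.le.trans ?_
  rw [Finset.card_filter]
  push_cast
  refine Finset.sum_le_sum fun n _ => ?_
  split_ifs with h
  · exact hf1 _
  · exact (hfU (fun hmem => h (hP n hmem))).le

/-- A sequence of natural numbers is equidistributed modulo every positive integer; this is stated
through lower bounds for the frequencies of the residue classes. -/
def EquidistributedMod (b : ℕ → ℕ) : Prop :=
  ∀ q : ℕ, 0 < q → ∀ r < q, ∀ ε : ℝ, 0 < ε →
    ∀ᶠ N : ℕ in atTop, (1 / q - ε) * N ≤ ((Finset.range N).filter (fun n => b n % q = r)).card

/-- Modulo `q`, the number `y` is congruent to `q t`, which lies strictly between `r` and `r + 1`.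
-/
lemma floor_mod_eq_of_mem {q r : ℕ} (hq : 0 < q) (hr : r < q) {y t : ℝ} (hy : 0 ≤ y)
    (ht : t ∈ Set.Ioo ((r : ℝ) / q) ((r + 1 : ℝ) / q))
    (h : ((y / q : ℝ) : AddCircle (1 : ℝ)) = t) : ⌊y⌋₊ % q = r := by
  have hq0 : (0 : ℝ) < q := by exact_mod_cast hq
  rw [← sub_eq_zero, ← AddCircle.coe_sub, AddCircle.coe_eq_zero_iff] at h
  obtain ⟨n, hn⟩ := h
  rw [zsmul_eq_mul, mul_one] at hn
  have hy' : y = q * t + q * n := by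
    rw [hn]; field_simp; ring
  have h1 := (div_lt_iff₀ hq0).1 ht.1
  have h2 := (lt_div_iff₀ hq0).1 ht.2
  have hfl : ⌊y⌋ = r + q * n := by
    rw [Int.floor_eq_iff]
    push_cast
    constructor <;> nlinarith
  have h3 : ((⌊y⌋₊ % q : ℕ) : ℤ) = r := by
    rw [Int.natCast_mod, Int.natCast_floor_eq_floor hy, hfl, Int.add_mul_emod_self_left]
    exact Int.emod_eq_of_lt (by omega) (by omega)
  exact_mod_cast h3

/-- The integer parts of the numbers `p ^ c`, `p` prime, are equidistributed in residue classes. -/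
theorem equidistributedMod_floor_prime_rpow {c : ℝ} (hc1 : 1 < c) (hc : ∀ m : ℤ, c ≠ m) :
    EquidistributedMod fun n => ⌊(Nat.nth Nat.Prime n : ℝ) ^ c⌋₊ := by
  intro q hq r hr ε hε
  have hq0 : (0 : ℝ) < q := by exact_mod_cast hq
  -- A negative threshold is trivial; the comparison with a measure below requires a nonnegative
  -- one.
  rcases lt_or_ge (1 / (q : ℝ) - ε) 0 with hneg | hpos
  · refine Eventually.of_forall fun N => ?_
    exact (mul_nonpos_of_nonpos_of_nonneg hneg.le (Nat.cast_nonneg N)).trans (Nat.cast_nonneg _)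
  set U : Set (AddCircle (1 : ℝ)) :=
    (fun t : ℝ => (t : AddCircle (1 : ℝ))) '' Set.Ioo ((r : ℝ) / q) ((r + 1 : ℝ) / q) with hU
  have hUo : IsOpen U := QuotientAddGroup.isOpenMap_coe _ isOpen_Ioo
  refine eventually_le_card_of_isOpen (x := fun n => (Nat.nth Nat.Prime n : ℝ) ^ c / q) ?_ hUo hpos
    ?_ ?_
  · intro m hm
    have h1 := tendsto_mean_e_prime hc1 hc (α := m / q) (by
      have : (m : ℝ) ≠ 0 := by exact_mod_cast hm
      positivity)
    refine h1.congr fun N => ?_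
    congr 1
    refine Finset.sum_congr rfl fun n _ => ?_
    congr 1
    ring
  · have hvol : ENNReal.ofReal (1 / q) ≤ volume U := by
      -- The fundamental interval is taken to start at `r / q`, so that the arc lifts to a single
      -- interval without wrapping around.
      rw [AddCircle.add_projection_respects_measure 1 ((r : ℝ) / q) hUo.measurableSet]
      have hle : volume (Set.Ioo ((r : ℝ) / q) ((r + 1 : ℝ) / q)) ≤
          volume (QuotientAddGroup.mk ⁻¹' U ∩ Set.Ioc ((r : ℝ) / q) (r / q + 1)) := by
        refine measure_mono fun t ht => ⟨⟨t, ht, rfl⟩, ht.1, ht.2.le.trans ?_⟩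
        have : (1 : ℝ) ≤ q := by exact_mod_cast hq
        rw [add_div]
        have : 1 / (q : ℝ) ≤ 1 := (div_le_one hq0).2 this
        linarith
      refine le_trans (le_of_eq ?_) hle
      rw [Real.volume_Ioo]
      congr 1
      ring
    refine lt_of_lt_of_le ?_ hvol
    exact (ENNReal.ofReal_lt_ofReal_iff (by positivity)).2 (by linarith)
  · rintro n ⟨t, ht, htn⟩
    exact floor_mod_eq_of_mem hq hr (by positivity) ht htn.symm

lemma equidistributedMod_id : EquidistributedMod fun n => n := by
  intro q hq r hr ε hε
  have hq0 : (0 : ℝ) < q := by exact_mod_cast hq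
  filter_upwards [eventually_ge_atTop ⌈1 / ε⌉₊] with N hN
  have h1 : 1 ≤ ε * N := by
    have : 1 / ε ≤ N := (Nat.le_ceil _).trans (by exact_mod_cast hN)
    rw [div_le_iff₀ hε] at this
    linarith
  have h2 := Nat.count_modEq_card N hq r
  have h3 : (Finset.range N).filter (fun n => n % q = r) =
      (Finset.range N).filter (fun n => n ≡ r [MOD q]) := by
    refine Finset.filter_congr fun n _ => ?_
    rw [Nat.ModEq, Nat.mod_eq_of_lt hr]
  rw [h3, ← Nat.count_eq_card_filter_range, h2]
  have h4 : (N : ℝ) < ((N / q : ℕ) + 1) * q := by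
    have := Nat.lt_mul_div_succ N hq
    rw [mul_comm] at this
    exact_mod_cast this
  have h5 : (N : ℝ) / q < (N / q : ℕ) + 1 := (div_lt_iff₀ hq0).2 h4
  have h6 : ((N / q : ℕ) : ℝ) ≤ ((N / q + if r % q < N % q then 1 else 0 : ℕ) : ℝ) := by
    exact_mod_cast Nat.le_add_right _ _
  refine le_trans ?_ h6
  have h7 : (1 / (q : ℝ) - ε) * N = N / q - ε * N := by ring
  rw [h7]
  linarith

/-! ### Reset words and residues modulo powers of k -/

section Automaton

variable {k : ℕ} {σ : Type} {A : Type*}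

/-- The word formed by the `j` least significant base-`k` digits of `n`, most significant first. -/
def lastDigits (hk : 2 ≤ k) : ℕ → ℕ → List (Fin k)
  | 0, _ => []
  | j + 1, n => lastDigits hk j (n / k) ++ [⟨n % k, Nat.mod_lt _ (by omega)⟩]

lemma lastDigits_add (hk : 2 ≤ k) (i j n : ℕ) :
    lastDigits hk (i + j) n = lastDigits hk i (n / k ^ j) ++ lastDigits hk j n := by
  induction j generalizing n with
  | zero => simp [lastDigits]
  | succ j ih =>
    rw [← add_assoc]
    simp only [lastDigits]
    rw [ih, List.append_assoc, Nat.div_div_eq_div_mul, pow_succ']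

lemma lastDigits_mod (hk : 2 ≤ k) (j n : ℕ) :
    lastDigits hk j (n % k ^ j) = lastDigits hk j n := by
  induction j generalizing n with
  | zero => rfl
  | succ j ih =>
    simp only [lastDigits]
    have h1 : n % k ^ (j + 1) / k = n / k % k ^ j := by
      rw [pow_succ', Nat.mod_mul_right_div_self]
    have h2 : n % k ^ (j + 1) % k = n % k := Nat.mod_mod_of_dvd _ (dvd_pow_self k (by omega))
    rw [h1, ih]
    simp only [h2]

/-- Digit words of fixed length are padded with leading zeros, so even a synchronizing word
beginning with 0 corresponds to a residue. -/
lemma exists_lastDigits_eq (hk : 2 ≤ k) (w : List (Fin k)) :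
    ∃ W < k ^ w.length, lastDigits hk w.length W = w := by
  induction w using List.reverseRecOn with
  | nil => exact ⟨0, by simp, rfl⟩
  | append_singleton w d ih =>
    obtain ⟨W, hW, hw⟩ := ih
    have hd := d.2
    refine ⟨k * W + d, ?_, ?_⟩
    · rw [List.length_append, List.length_singleton, pow_succ']
      calc k * W + d < k * W + k := by omega
        _ = k * (W + 1) := by ring
        _ ≤ k * k ^ w.length := Nat.mul_le_mul_left _ hW
    · rw [List.length_append, List.length_singleton]
      simp only [lastDigits]
      have h1 : (k * W + d) / k = W := by
        rw [Nat.mul_add_div (by omega), Nat.div_eq_of_lt hd, add_zero]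
      have h2 : (k * W + d) % k = d := by
        rw [Nat.mul_add_mod, Nat.mod_eq_of_lt hd]
      rw [h1, hw]
      simp only [h2]

lemma baseExpansion_eq_append (hk : 2 ≤ k) {n : ℕ} (hn : 0 < n) :
    baseExpansion k hk n = baseExpansion k hk (n / k) ++ [⟨n % k, Nat.mod_lt _ (by omega)⟩] := by
  unfold baseExpansion
  apply List.map_injective_iff.2 Fin.val_injective
  rw [List.map_append, List.map_pmap, List.map_pmap]
  simp only [List.pmap_eq_map, List.map_id', List.map_cons, List.map_nil]
  rw [Nat.digits_def' (by omega) hn, List.reverse_cons]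

lemma run_append (M : OutputAutomaton k σ A) (s : σ) (u v : List (Fin k)) :
    M.run s (u ++ v) = M.run (M.run s u) v := by
  simp [OutputAutomaton.run]

/-- The state after reading `n` is obtained from some state by reading the last `j` digits. -/
lemma exists_run_baseExpansion_eq (hk : 2 ≤ k) (M : OutputAutomaton k σ A) (s : σ) (j : ℕ) :
    ∀ n, k ^ j ≤ n → ∃ t, M.run s (baseExpansion k hk n) = M.run t (lastDigits hk j n) := by
  induction j with
  | zero => intro n _; exact ⟨_, rfl⟩
  | succ j ih =>
    intro n hn
    have hk0 : 0 < k := by omega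
    have hn0 : 0 < n := lt_of_lt_of_le (by positivity) hn
    have h1 : k ^ j ≤ n / k := by
      rw [Nat.le_div_iff_mul_le hk0, ← pow_succ]
      exact hn
    obtain ⟨t, ht⟩ := ih (n / k) h1
    refine ⟨t, ?_⟩
    rw [baseExpansion_eq_append hk hn0, run_append, ht]
    simp only [lastDigits]
    rw [run_append]

/-- Reading the word `u` leads to a state independent of the starting state. -/
def IsReset (M : OutputAutomaton k σ A) (u : List (Fin k)) : Prop :=
  ∀ s, M.run s u = M.run M.start u

lemma IsReset.append_right {M : OutputAutomaton k σ A} {u : List (Fin k)} (h : IsReset M u)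
    (v : List (Fin k)) : IsReset M (u ++ v) := fun s => by
  rw [run_append, run_append, h s]

/-- Reading `u` first only changes the state from which `v` is read. With the companion lemma for
suffixes, any word containing a reset factor is a reset word. -/
lemma IsReset.append_left {M : OutputAutomaton k σ A} {v : List (Fin k)} (h : IsReset M v)
    (u : List (Fin k)) : IsReset M (u ++ v) := fun s => by
  rw [run_append, run_append, h, ← h (M.run M.start u)]

open Classical in
/-- The residues modulo `k ^ L` whose digit word is not a reset word. -/
noncomputable def nonResetResidues (hk : 2 ≤ k) (M : OutputAutomaton k σ A) (L : ℕ) : Finset ℕ :=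
  (Finset.range (k ^ L)).filter (fun r => ¬ IsReset M (lastDigits hk L r))

/-- Cut into `t` blocks of length `|w|`, the digit word of a non-reset residue has no block equal to
`w`, so each block takes at most `k ^ |w| - 1` values. The induction splits off the last block by
division with remainder by `Q`. -/
lemma card_nonResetResidues_le (hk : 2 ≤ k) (M : OutputAutomaton k σ A) {w : List (Fin k)}
    (hw : IsReset M w) (t : ℕ) :
    (nonResetResidues hk M (t * w.length)).card ≤ (k ^ w.length - 1) ^ t := by
  classical
  induction t with
  | zero =>
    refine (Finset.card_filter_le _ _).trans ?_
    simp
  | succ t ih =>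
    obtain ⟨W, hW, hWw⟩ := exists_lastDigits_eq hk w
    set Q := k ^ w.length with hQ
    have hQ0 : 0 < Q := Nat.pow_pos (by omega)
    have hcard : ((nonResetResidues hk M (t * w.length)) ×ˢ ((Finset.range Q).erase W)).card ≤
        (Q - 1) ^ (t + 1) := by
      rw [Finset.card_product, Finset.card_erase_of_mem (Finset.mem_range.2 hW),
        Finset.card_range, pow_succ]
      exact Nat.mul_le_mul_right _ ih
    refine le_trans (Finset.card_le_card_of_injOn (fun r => (r / Q, r % Q)) ?_ ?_) hcard
    · intro r hr
      have hr' : r < k ^ ((t + 1) * w.length) ∧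
          ¬ IsReset M (lastDigits hk ((t + 1) * w.length) r) := by
        simpa [nonResetResidues] using hr
      obtain ⟨hr1, hr2⟩ := hr'
      rw [Nat.succ_mul, lastDigits_add] at hr2
      rw [Nat.succ_mul, pow_add] at hr1
      simp only [Finset.coe_product, Set.mem_prod, Finset.mem_coe, Finset.mem_erase,
        Finset.mem_range, nonResetResidues, Finset.mem_filter]
      refine ⟨⟨?_, fun h => hr2 (h.append_right _)⟩, ?_, Nat.mod_lt _ hQ0⟩
      · exact Nat.div_lt_of_lt_mul (by rw [mul_comm]; exact hr1)
      · intro h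
        refine hr2 (IsReset.append_left ?_ _)
        rw [← lastDigits_mod, ← hQ, h, hWw]
        exact hw
    · intro x _ y _ hxy
      simp only [Prod.mk.injEq] at hxy
      rw [← Nat.div_add_mod x Q, ← Nat.div_add_mod y Q, hxy.1, hxy.2]

/-- Residues modulo a high power of `k` determine the state, up to a small proportion. -/
lemma exists_card_nonResetResidues_le (hk : 2 ≤ k) (M : OutputAutomaton k σ A)
    {w : List (Fin k)} (hw : IsReset M w) {ε : ℝ} (hε : 0 < ε) :
    ∃ L, ((nonResetResidues hk M L).card : ℝ) ≤ ε * (k ^ L : ℕ) := by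
  set Q := k ^ w.length with hQ
  have hQ0 : 0 < Q := Nat.pow_pos (by omega)
  have hQ0' : (0 : ℝ) < Q := by exact_mod_cast hQ0
  have hQ1 : (1 : ℝ) ≤ Q := by exact_mod_cast hQ0
  have hinv : 0 < 1 / (Q : ℝ) := by positivity
  have hinv' : 1 / (Q : ℝ) ≤ 1 := (div_le_one hQ0').2 hQ1
  -- The proportion of non-reset residues is at most `(1 - 1 / Q) ^ t`, which tends to zero with the
  -- number of blocks.
  obtain ⟨t, ht⟩ := exists_pow_lt_of_lt_one hε (by linarith : 1 - 1 / (Q : ℝ) < 1)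
  refine ⟨t * w.length, ?_⟩
  have h1 : ((nonResetResidues hk M (t * w.length)).card : ℝ) ≤ (((Q - 1) ^ t : ℕ) : ℝ) := by
    exact_mod_cast card_nonResetResidues_le hk M hw t
  refine h1.trans ?_
  rw [mul_comm t, pow_mul, ← hQ]
  push_cast [Nat.cast_sub hQ0]
  calc ((Q : ℝ) - 1) ^ t = (1 - 1 / (Q : ℝ)) ^ t * (Q : ℝ) ^ t := by
        rw [← mul_pow]; congr 1; field_simp
    _ ≤ ε * (Q : ℝ) ^ t := by gcongr

end Automaton

/-! ### Frequencies along equidistributed sequences -/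

lemma EquidistributedMod.eventually_le_card {b : ℕ → ℕ} (hb : EquidistributedMod b) {q : ℕ}
    (hq : 0 < q) (R : Finset ℕ) (hR : ∀ r ∈ R, r < q) {ε : ℝ} (hε : 0 < ε) :
    ∀ᶠ N : ℕ in atTop, ((R.card : ℝ) / q - ε) * N ≤
      ((Finset.range N).filter (fun n => b n % q ∈ R)).card := by
  have hR0 : (0 : ℝ) < R.card + 1 := by positivity
  -- The errors `ε / (|R| + 1)` add up to at most `ε` over `R`; the `+ 1` allows `R` to be empty.
  have h1 : ∀ᶠ N : ℕ in atTop, ∀ r ∈ R, (1 / q - ε / (R.card + 1)) * N ≤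
      ((Finset.range N).filter (fun n => b n % q = r)).card :=
    (Filter.eventually_all_finset R).2 fun r hr => hb q hq r (hR r hr) _ (by positivity)
  filter_upwards [h1] with N hN
  have h2 : ((Finset.range N).filter (fun n => b n % q ∈ R)).card =
      ∑ r ∈ R, ((Finset.range N).filter (fun n => b n % q = r)).card := by
    have hmaps : ∀ n ∈ (Finset.range N).filter (fun n => b n % q ∈ R), b n % q ∈ R :=
      fun n hn => (Finset.mem_filter.1 hn).2
    rw [Finset.card_eq_sum_card_fiberwise hmaps]
    refine Finset.sum_congr rfl fun r hr => ?_
    rw [Finset.filter_filter]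
    congr 1
    refine Finset.filter_congr fun n _ => ?_
    constructor
    · rintro ⟨_, h⟩; exact h
    · intro h; exact ⟨by rw [h]; exact hr, h⟩
  rw [h2]
  push_cast
  refine le_trans ?_ (Finset.sum_le_sum hN)
  rw [Finset.sum_const, nsmul_eq_mul, ← mul_assoc]
  refine mul_le_mul_of_nonneg_right ?_ (Nat.cast_nonneg N)
  have h3 : (R.card : ℝ) * (ε / (R.card + 1)) ≤ ε := by
    rw [mul_div_assoc', div_le_iff₀ hR0]
    nlinarith
  have h4 : (R.card : ℝ) * (1 / q - ε / (R.card + 1)) =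
      R.card / q - R.card * (ε / (R.card + 1)) := by ring
  rw [h4]
  linarith

/-- A property that holds for all large integers in given residue classes holds with at least the
corresponding frequency along an equidistributed sequence. -/
lemma EquidistributedMod.eventually_le_card_of_forall {b : ℕ → ℕ} (hb : EquidistributedMod b)
    (hb' : Tendsto b atTop atTop) {q : ℕ} (hq : 0 < q) (R : Finset ℕ) (hR : ∀ r ∈ R, r < q)
    {P : ℕ → Prop} [DecidablePred P] {m₀ : ℕ} (hP : ∀ n, m₀ ≤ n → n % q ∈ R → P n)
    {ε : ℝ} (hε : 0 < ε) :
    ∀ᶠ N : ℕ in atTop, ((R.card : ℝ) / q - ε) * N ≤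
      ((Finset.range N).filter (fun n => P (b n))).card := by
  -- Only the first `n₁` terms can lie below `m₀`; half of `ε` pays for them, the other half for the
  -- equidistribution.
  obtain ⟨n₁, hn₁⟩ := eventually_atTop.1 (hb'.eventually_ge_atTop m₀)
  filter_upwards [hb.eventually_le_card hq R hR (half_pos hε),
    eventually_ge_atTop ⌈n₁ / (ε / 2)⌉₊] with N h1 h2
  have h3 : (n₁ : ℝ) ≤ ε / 2 * N := by
    have : n₁ / (ε / 2) ≤ (N : ℝ) := (Nat.le_ceil _).trans (by exact_mod_cast h2)
    rw [div_le_iff₀ (half_pos hε)] at this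
    linarith
  have h4 : ((Finset.range N).filter (fun n => b n % q ∈ R)).card ≤
      ((Finset.range N).filter (fun n => P (b n))).card + n₁ := by
    have hsub : (Finset.range N).filter (fun n => b n % q ∈ R) ⊆
        (Finset.range N).filter (fun n => P (b n)) ∪ Finset.range n₁ := by
      intro n hn
      rw [Finset.mem_filter] at hn
      rw [Finset.mem_union, Finset.mem_filter]
      rcases Nat.lt_or_ge n n₁ with h | h
      · exact Or.inr (Finset.mem_range.2 h)
      · exact Or.inl ⟨hn.1, hP _ (hn₁ n h) hn.2⟩
    refine (Finset.card_le_card hsub).trans ((Finset.card_union_le _ _).trans ?_)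
    rw [Finset.card_range]
  have h5 : (((Finset.range N).filter (fun n => b n % q ∈ R)).card : ℝ) ≤
      ((Finset.range N).filter (fun n => P (b n))).card + n₁ := by exact_mod_cast h4
  have h6 : ((R.card : ℝ) / q - ε) * N = ((R.card : ℝ) / q - ε / 2) * N - ε / 2 * N := by ring
  rw [h6]
  linarith

open Classical in
/-- The frequencies of a letter of a synchronizing automatic sequence along equidistributed
sequences are approximated by a common value. -/
lemma exists_frequency_approx {A : Type*} {k : ℕ} (hk : 2 ≤ k) {a : ℕ → A}
    (ha : IsSynchronizingAutomatic k hk a) (α : A) {ε : ℝ} (hε : 0 < ε) :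
    ∃ v : ℝ, ∀ b : ℕ → ℕ, EquidistributedMod b → Tendsto b atTop atTop → ∀ᶠ N : ℕ in atTop,
      |(((Finset.range N).filter (fun n => a (b n) = α)).card : ℝ) / N - v| ≤ ε := by
  obtain ⟨σ, _, M, hgen, w, s₀, hs₀⟩ := ha
  have hw : IsReset M w := fun s => by rw [hs₀, hs₀]
  obtain ⟨L, hL⟩ := exists_card_nonResetResidues_le hk M hw (half_pos hε)
  set q := k ^ L with hq
  have hq0 : 0 < q := Nat.pow_pos (by omega)
  have hq0' : (0 : ℝ) < q := by exact_mod_cast hq0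
  set G := (Finset.range q).filter (fun r => IsReset M (lastDigits hk L r)) with hG
  set s : ℕ → A := fun r => M.output (M.run M.start (lastDigits hk L r)) with hs
  -- The bound `q ≤ n` guarantees that `n` has at least `L` genuine digits, so that its base-`k`
  -- expansion ends in the word `lastDigits hk L n`.
  have key : ∀ n, q ≤ n → n % q ∈ G → a n = s (n % q) := by
    intro n hn hmem
    have hres : IsReset M (lastDigits hk L n) := by
      have := (Finset.mem_filter.1 hmem).2
      rwa [hq, lastDigits_mod] at this
    obtain ⟨t, ht⟩ := exists_run_baseExpansion_eq hk M M.start L n hn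
    simp only [hs]
    rw [hgen n, ht, hres t, hq, lastDigits_mod]
  -- Equidistribution is available only as lower bounds. Applied to the residues that force the
  -- letter `α` and to those that exclude it, which together omit a proportion of at most `ε / 2`,
  -- it bounds the frequency of `α` from both sides around `|G₁| / q`. This value does not depend on
  -- the sequence `b`.
  set G₁ := G.filter (fun r => s r = α) with hG₁
  set G₂ := G.filter (fun r => ¬ s r = α) with hG₂
  have hcard : (q : ℝ) ≤ G₁.card + G₂.card + ε / 2 * q := by
    have h1 : G₁.card + G₂.card = G.card := Finset.card_filter_add_card_filter_not _
    have h2 : G.card + (nonResetResidues hk M L).card = q := by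
      have := Finset.card_filter_add_card_filter_not (s := Finset.range q)
        (fun r => IsReset M (lastDigits hk L r))
      rw [Finset.card_range] at this
      exact this
    have h3 : (q : ℝ) = G₁.card + G₂.card + (nonResetResidues hk M L).card := by
      exact_mod_cast (by omega)
    linarith
  have hlt : ∀ r ∈ G, r < q := fun r hr => Finset.mem_range.1 (Finset.mem_filter.1 hr).1
  refine ⟨(G₁.card : ℝ) / q, fun b hb hb' => ?_⟩
  have e1 := hb.eventually_le_card_of_forall hb' hq0 G₁
    (fun r hr => hlt r (Finset.mem_filter.1 hr).1) (P := fun n => a n = α) (m₀ := q)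
    (fun n hn hmem => by
      rw [key n hn (Finset.mem_filter.1 hmem).1]
      exact (Finset.mem_filter.1 hmem).2) (half_pos hε)
  have e2 := hb.eventually_le_card_of_forall hb' hq0 G₂
    (fun r hr => hlt r (Finset.mem_filter.1 hr).1) (P := fun n => ¬ a n = α) (m₀ := q)
    (fun n hn hmem => by
      rw [key n hn (Finset.mem_filter.1 hmem).1]
      exact (Finset.mem_filter.1 hmem).2) (half_pos hε)
  filter_upwards [e1, e2, eventually_gt_atTop 0] with N h1 h2 hN
  have hN0 : (0 : ℝ) < N := by exact_mod_cast hN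
  have h3 : (((Finset.range N).filter (fun n => a (b n) = α)).card : ℝ) +
      ((Finset.range N).filter (fun n => ¬ a (b n) = α)).card = N := by
    have := Finset.card_filter_add_card_filter_not (s := Finset.range N) (fun n => a (b n) = α)
    rw [Finset.card_range] at this
    exact_mod_cast this
  have h4 : 1 ≤ (G₁.card : ℝ) / q + (G₂.card : ℝ) / q + ε / 2 := by
    have := div_le_div_of_nonneg_right hcard hq0'.le
    rw [div_self hq0'.ne', add_div, add_div, mul_div_assoc, div_self hq0'.ne', mul_one] at this
    exact this
  rw [abs_le]
  constructor
  · rw [neg_le_sub_iff_le_add, ← sub_le_iff_le_add, le_div_iff₀ hN0]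
    nlinarith
  · rw [sub_le_iff_le_add, div_le_iff₀ hN0]
    nlinarith

lemma tendsto_floor_prime_rpow {c : ℝ} (hc1 : 1 < c) :
    Tendsto (fun n => ⌊(Nat.nth Nat.Prime n : ℝ) ^ c⌋₊) atTop atTop := by
  have hinf := Nat.infinite_setOfPred_prime
  refine tendsto_atTop_mono (fun n => ?_) (Nat.nth_strictMono hinf).tendsto_atTop
  refine Nat.le_floor ?_
  have h1 : (1 : ℝ) ≤ Nat.nth Nat.Prime n := by
    exact_mod_cast (Nat.nth_mem_of_infinite hinf n).one_le
  calc (Nat.nth Nat.Prime n : ℝ) = (Nat.nth Nat.Prime n : ℝ) ^ (1 : ℝ) := (Real.rpow_one _).symm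
    _ ≤ _ := Real.rpow_le_rpow_of_exponent_le h1 hc1.le

open Classical in
lemma hasFrequency_iff {A : Type*} (b : ℕ → A) (α : A) (ϑ : ℝ) : HasFrequency b α ϑ ↔
    Tendsto (fun N : ℕ => (((Finset.range N).filter (fun n => b n = α)).card : ℝ) / N) atTop
      (𝓝 ϑ) := by
  unfold HasFrequency
  have : ∀ N : ℕ, Set.ncard {n : ℕ | n < N ∧ b n = α} =
      ((Finset.range N).filter (fun n => b n = α)).card := by
    intro N
    rw [← Set.ncard_coe_finset]
    congr 1
    ext n
    simp
  simp only [this]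

/-- Two sequences that share approximate limits at every scale converge to a common limit. -/
lemma exists_tendsto_of_approx {x y : ℕ → ℝ} (h : ∀ ε : ℝ, 0 < ε → ∃ v : ℝ,
    (∀ᶠ N in atTop, |x N - v| ≤ ε) ∧ ∀ᶠ N in atTop, |y N - v| ≤ ε) :
    ∃ l, Tendsto x atTop (𝓝 l) ∧ Tendsto y atTop (𝓝 l) := by
  have hx : CauchySeq x := by
    rw [Metric.cauchySeq_iff']
    intro ε hε
    obtain ⟨v, h1, -⟩ := h (ε / 3) (by linarith)
    obtain ⟨N₀, hN₀⟩ := eventually_atTop.1 h1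
    refine ⟨N₀, fun n hn => ?_⟩
    have a1 := abs_le.1 (hN₀ n hn)
    have a2 := abs_le.1 (hN₀ N₀ le_rfl)
    rw [Real.dist_eq, abs_lt]
    constructor <;> linarith
  obtain ⟨l, hl⟩ := cauchySeq_tendsto_of_complete hx
  refine ⟨l, hl, ?_⟩
  rw [Metric.tendsto_atTop'] at *
  intro ε hε
  obtain ⟨v, h1, h2⟩ := h (ε / 4) (by linarith)
  obtain ⟨N₁, hN₁⟩ := hl (ε / 4) (by linarith)
  obtain ⟨N₂, hN₂⟩ := eventually_atTop.1 (h1.and h2)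
  refine ⟨max N₁ N₂, fun n hn => ?_⟩
  have a1 := hN₁ n ((le_max_left _ _).trans_lt hn)
  have a2 := hN₂ n ((le_max_right _ _).trans hn.le)
  have a3 := abs_le.1 a2.1
  have a4 := abs_le.1 a2.2
  rw [Real.dist_eq, abs_lt] at *
  constructor <;> linarith

end PrimePowerSums

theorem mainTheorem5 {A : Type*} (k : ℕ) (hk : 2 ≤ k) (a : ℕ → A)
    (ha : IsSynchronizingAutomatic k hk a)
    (c : ℝ) (hc : 1 < c) (hcint : ∀ m : ℤ, c ≠ (m : ℝ)) (α : A) :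
    ∃ ϑ : ℝ, HasFrequency a α ϑ ∧
      HasFrequency (fun n : ℕ => a ⌊((Nat.nth Nat.Prime n : ℕ) : ℝ) ^ c⌋₊) α ϑ := by
  simp only [PrimePowerSums.hasFrequency_iff]
  refine PrimePowerSums.exists_tendsto_of_approx fun ε hε => ?_
  obtain ⟨v, hv⟩ := PrimePowerSums.exists_frequency_approx hk ha α hε
  exact ⟨v, hv _ PrimePowerSums.equidistributedMod_id tendsto_id,
    hv _ (PrimePowerSums.equidistributedMod_floor_prime_rpow hc hcint)
      (PrimePowerSums.tendsto_floor_prime_rpow hc)⟩
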